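/- Let $X$ be a uniform space. Let $U_b(X)$ be the Banach space of bounded uniformly continuous functions $X\to\mathbb{R}$ with the sup norm. A set $\mathcal H\subseteq U_b(X)$ is called a ueb set if it is uniformly equicontinuous and bounded in the sup norm; the ueb topology on the Banach space dual $U_b(X)^*$ is the topology of uniform convergence on ueb sets. The space $\mathfrak M(X)$ of uniform measures on $X$ is the ueb closure in $U_b(X)^*$ of the linear span of the point masses $\delta_x\colon f\mapsto f(x)$, $x\in X$, and its positive cone is $\mathfrak M(X)^+=\{\mu\in\mathfrak M(X) : \mu(f)\ge 0 \text{ for all } f\in U_b(X),\ f\ge 0\}$; both carry the ueb topology. Every uniformly continuous map $\varphi\colon X\to Y$ induces the continuous linear map $\mathfrak M(\varphi)\colon\mathfrak M(X)\to\mathfrak M(Y)$, $\mathfrak M(\varphi)(\mu)(f)=\mu(f\circ\varphi)$, which is the unique continuous linear map with $\delta_x\mapsto\delta_{\varphi(x)}$, and which maps $\mathfrak M(X)^+$ into $\mathfrak M(Y)^+$. Let $G$ be a Hausdorff topological group. Let $G_L$ and $G_R$ be the set $G$ with its left and right uniformity: the entourages $\{(x,y) : x^{-1}y\in U\}$, respectively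 $\{(x,y) : yx^{-1}\in U\}$, with $U$ a neighbourhood of the identity, form a base (equivalently, these uniformities are induced by the left invariant, respectively right invariant, continuous pseudometrics on $G$). Let $G_\vee$ be $G$ with the upper uniformity, the coarsest uniformity finer than both the left and the right one, and let $G_\wedge$ be $G$ with the lower (Roelcke) uniformity, the finest uniformity coarser than both. For $\alpha\beta\in\{\vee L,\vee R,L\wedge,R\wedge,\vee\wedge\}$ let $\iota_{\alpha\beta}\colon G_\alpha\to G_\beta$ be the uniformly continuous identity map. **Theorem.** For every $\alpha\beta\in\{\vee L,\vee R,L\wedge,R\wedge,\vee\wedge\}$ the map $\mathfrak M(\iota_{\alpha\beta})\colon\mathfrak M(G_\alpha)\to\mathfrak M(G_\beta)$ is injective, and its restriction $\mathfrak M(G_\alpha)^+\to\mathfrak M(G_\beta)^+$ is a topological embedding (a homeomorphism onto its image) for the ueb topologies. Moreover, $$\mathfrak M(\iota_{\vee\wedge})\bigl(\mathfrak M(G_\vee)\bigr)=\mathfrak M(\iota_{L\wedge})\bigl(\mathfrak M(G_L)\bigr)\cap\mathfrak M(\iota_{R\wedge})\bigl(\mathfrak M(G_R)\bigr).$$ 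-/

import Mathlib

open scoped Topology BoundedContinuousFunction UniformConvergenceCLM

noncomputable section

section UniformMeasures

/-- `Ub X`: the space of bounded uniformly continuous real-valued functions on `X`,
with the sup norm (inherited from `X →ᵇ ℝ`). -/
def Ub (X : Type*) [UniformSpace X] : Submodule ℝ (X →ᵇ ℝ) where
  carrier := {f | UniformContinuous f}
  add_mem' hf hg := UniformContinuous.add hf hg
  zero_mem' := uniformContinuous_const
  smul_mem' c _ hf := UniformContinuous.const_smul hf c

/-- A set of functions in `Ub X` is a `ueb` set if it is uniformly equicontinuous and
uniformly bounded in the sup norm. -/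
def IsUeb {X : Type*} [UniformSpace X] (H : Set (Ub X)) : Prop :=
  UniformEquicontinuous (fun (f : H) (x : X) => (f : Ub X).1 x) ∧ ∃ C : ℝ, ∀ f ∈ H, ‖f‖ ≤ C

/-- The Banach space dual of `Ub X`, with the `ueb` topology, that is, the topology of
uniform convergence on `ueb` sets. -/
abbrev UbDual (X : Type*) [UniformSpace X] : Type _ :=
  UniformConvergenceCLM (RingHom.id ℝ) (E := Ub X) ℝ {H | IsUeb H}

/-- The point mass at `x`: the functional `f ↦ f x`. -/
def pointMass {X : Type*} [UniformSpace X] (x : X) : UbDual X :=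
  UniformConvergenceCLM.ofFun (RingHom.id ℝ) ℝ {H | IsUeb H}
    ((BoundedContinuousFunction.evalCLM ℝ x).comp (Ub X).subtypeL)

theorem pointMass_apply {X : Type*} [UniformSpace X] (x : X) (f : Ub X) :
    pointMass x f = f.1 x := rfl

/-- Molecular measures: finite linear combinations of point masses. -/
def Mol (X : Type*) [UniformSpace X] : Submodule ℝ (UbDual X) :=
  Submodule.span ℝ (Set.range pointMass)

/-- The space of uniform measures: the `ueb` closure of the molecular measures in the dual of
`Ub X`.  As a topological space it carries the subspace topology, i.e. the `ueb` topology. -/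
def UMeas (X : Type*) [UniformSpace X] : Submodule ℝ (UbDual X) :=
  (Mol X).topologicalClosure

/-- The positive cone of `UMeas X`: the uniform measures that are nonnegative on nonnegative
functions. -/
def UMeasPos (X : Type*) [UniformSpace X] : Set (UMeas X) :=
  {m | ∀ f : Ub X, (∀ x, 0 ≤ f.1 x) → 0 ≤ m.1 f}

variable {X Y : Type*} [UniformSpace X] [UniformSpace Y]

theorem norm_comp_le_aux (φ : X → Y) (hφ : UniformContinuous φ) (f : Ub Y) :
    ‖f.1.compContinuous ⟨φ, hφ.continuous⟩‖ ≤ ‖f‖ :=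
  (BoundedContinuousFunction.norm_le (norm_nonneg f)).2 fun x => f.1.norm_coe_le_norm (φ x)

/-- Composition with a uniformly continuous map `φ : X → Y`, `f ↦ f ∘ φ`, as a linear map. -/
def Ub.compLinear (φ : X → Y) (hφ : UniformContinuous φ) : Ub Y →ₗ[ℝ] Ub X where
  toFun f := ⟨f.1.compContinuous ⟨φ, hφ.continuous⟩, UniformContinuous.comp f.2 hφ⟩
  map_add' _ _ := rfl
  map_smul' _ _ := rfl

/-- Composition with a uniformly continuous map `φ : X → Y`, `f ↦ f ∘ φ`. -/
def Ub.comp (φ : X → Y) (hφ : UniformContinuous φ) : Ub Y →L[ℝ] Ub X where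
  toLinearMap := Ub.compLinear φ hφ
  cont := AddMonoidHomClass.continuous_of_bound (Ub.compLinear φ hφ) 1 fun f =>
    (norm_comp_le_aux φ hφ f).trans_eq (one_mul ‖f‖).symm

theorem Ub.comp_apply (φ : X → Y) (hφ : UniformContinuous φ) (f : Ub Y) (x : X) :
    (Ub.comp φ hφ f).1 x = f.1 (φ x) := rfl

theorem IsUeb.comp (φ : X → Y) (hφ : UniformContinuous φ) :
    Set.MapsTo (Ub.comp φ hφ '' ·) {H | IsUeb H} {H | IsUeb H} := by
  rintro H ⟨hH, C, hC⟩
  refine ⟨fun U hU => ?_, C, ?_⟩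
  · have h := hφ.eventually (hH U hU)
    filter_upwards [h] with p hp
    rintro ⟨_, f, hf, rfl⟩
    exact hp ⟨f, hf⟩
  · rintro _ ⟨f, hf, rfl⟩
    exact (norm_comp_le_aux φ hφ f).trans (hC f hf)

/-- Push-forward of functionals, `φ_* m (f) = m (f ∘ φ)`, continuous in the `ueb` topologies. -/
def UbDual.map (φ : X → Y) (hφ : UniformContinuous φ) : UbDual X →L[ℝ] UbDual Y :=
  ContinuousLinearMap.precompUniformConvergenceCLM ℝ {H | IsUeb H} {H | IsUeb H}
    (Ub.comp φ hφ) (IsUeb.comp φ hφ)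

theorem UbDual.map_apply (φ : X → Y) (hφ : UniformContinuous φ) (m : UbDual X) (f : Ub Y) :
    UbDual.map φ hφ m f = m (Ub.comp φ hφ f) := rfl

theorem UbDual.map_mem (φ : X → Y) (hφ : UniformContinuous φ) (m : UbDual X)
    (hm : m ∈ UMeas X) : UbDual.map φ hφ m ∈ UMeas Y := by
  have h1 : Mol X ≤ (Mol Y).comap (UbDual.map φ hφ).toLinearMap := by
    refine Submodule.span_le.2 ?_
    rintro _ ⟨x, rfl⟩
    exact Submodule.subset_span ⟨φ x, rfl⟩
  exact map_mem_closure (UbDual.map φ hφ).continuous hm fun a ha => h1 ha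

/-- The continuous linear map `UMeas X → UMeas Y` induced by a uniformly continuous map
`φ : X → Y`. -/
def UMeas.map (φ : X → Y) (hφ : UniformContinuous φ) : UMeas X →L[ℝ] UMeas Y :=
  ((UbDual.map φ hφ).comp (UMeas X).subtypeL).codRestrict (UMeas Y)
    (fun m => UbDual.map_mem φ hφ m.1 m.2)

theorem UMeas.map_apply (φ : X → Y) (hφ : UniformContinuous φ) (m : UMeas X) (f : Ub Y) :
    (UMeas.map φ hφ m).1 f = m.1 (Ub.comp φ hφ f) := rfl

/-- The point mass at `x` as a uniform measure. -/
def UMeas.dirac (x : X) : UMeas X :=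
  ⟨pointMass x, (Mol X).le_topologicalClosure (Submodule.subset_span ⟨x, rfl⟩)⟩

theorem UMeas.map_dirac (φ : X → Y) (hφ : UniformContinuous φ) (x : X) :
    UMeas.map φ hφ (UMeas.dirac x) = UMeas.dirac (φ x) := rfl

theorem UMeas.map_mapsTo (φ : X → Y) (hφ : UniformContinuous φ) :
    Set.MapsTo (UMeas.map φ hφ) (UMeasPos X) (UMeasPos Y) :=
  fun _ hm f hf => hm (Ub.comp φ hφ f) fun x => hf (φ x)

/-- The restriction of `UMeas.map φ` to the positive cones. -/
def UMeas.mapPos (φ : X → Y) (hφ : UniformContinuous φ) : UMeasPos X → UMeasPos Y :=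
  (UMeas.map_mapsTo φ hφ).restrict

theorem isUeb_singleton (f : Ub X) : IsUeb {f} := by
  refine ⟨fun U hU => ?_, ‖f‖, ?_⟩
  · filter_upwards [f.2 hU] with p hp
    rintro ⟨_, rfl⟩
    exact hp
  · rintro _ rfl
    exact le_rfl

instance UbDual.instT2Space : T2Space (UbDual X) :=
  UniformConvergenceCLM.t2Space (RingHom.id ℝ) ℝ {H : Set (Ub X) | IsUeb H}
    (Set.eq_univ_of_forall fun f => ⟨{f}, isUeb_singleton f, rfl⟩)

/-- `UMeas.map φ` is the only continuous linear extension of `φ`. -/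
theorem UMeas.map_unique (φ : X → Y) (hφ : UniformContinuous φ) (T : UMeas X →L[ℝ] UMeas Y)
    (hT : ∀ x, T (UMeas.dirac x) = UMeas.dirac (φ x)) : T = UMeas.map φ hφ := by
  have hle : Mol X ≤ UMeas X := (Mol X).le_topologicalClosure
  let L : Submodule ℝ (UMeas X) := LinearMap.eqLocus T.toLinearMap (UMeas.map φ hφ).toLinearMap
  have h1 : Mol X ≤ L.map (UMeas X).subtype := by
    refine Submodule.span_le.2 ?_
    rintro _ ⟨x, rfl⟩
    exact ⟨UMeas.dirac x, (hT x).trans (UMeas.map_dirac φ hφ x).symm, rfl⟩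
  have hcl : IsClosed (L : Set (UMeas X)) :=
    isClosed_eq T.continuous (UMeas.map φ hφ).continuous
  ext1 m
  have hm : m ∈ closure (L : Set (UMeas X)) := by
    rw [closure_subtype]
    exact closure_mono h1 m.2
  exact hcl.closure_subset hm

end UniformMeasures

section Uniformities

/-- The set `X` regarded as a uniform space with the uniformity `u`. -/
def WithUniformity {X : Type*} (_u : UniformSpace X) : Type _ := X

instance WithUniformity.instUniformSpace {X : Type*} (u : UniformSpace X) :
    UniformSpace (WithUniformity u) := u

/-- The identity map of `X`, from the uniformity `u` to the uniformity `v`. -/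
def WithUniformity.idMap {X : Type*} (u v : UniformSpace X) :
    WithUniformity u → WithUniformity v := fun x => x

/-- In Mathlib's order on uniformities `u ≤ v` means that `u` is finer than `v`; then the
identity map is uniformly continuous from `u` to `v`. -/
theorem WithUniformity.uniformContinuous_idMap {X : Type*} {u v : UniformSpace X} (h : u ≤ v) :
    UniformContinuous (WithUniformity.idMap u v) :=
  UniformSpace.le_def.1 h

/-- The map `UMeas (X, u) → UMeas (X, v)` induced by the identity, for `u` finer than `v`. -/
def idMeas {X : Type*} {u v : UniformSpace X} (h : u ≤ v) :
    UMeas (WithUniformity u) →L[ℝ] UMeas (WithUniformity v) :=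
  UMeas.map (WithUniformity.idMap u v) (WithUniformity.uniformContinuous_idMap h)

/-- The restriction of `idMeas` to the positive cones. -/
def idMeasPos {X : Type*} {u v : UniformSpace X} (h : u ≤ v) :
    UMeasPos (WithUniformity u) → UMeasPos (WithUniformity v) :=
  UMeas.mapPos (WithUniformity.idMap u v) (WithUniformity.uniformContinuous_idMap h)

variable (G : Type*) [Group G] [TopologicalSpace G] [IsTopologicalGroup G]

/-- The left uniformity: a base of entourages is `{(x, y) | x⁻¹ * y ∈ U}`, `U` a neighbourhood
of the identity. -/
abbrev leftUnif : UniformSpace G := IsTopologicalGroup.leftUniformSpace G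

/-- The right uniformity: a base of entourages is `{(x, y) | y * x⁻¹ ∈ U}`, `U` a neighbourhood
of the identity. -/
abbrev rightUnif : UniformSpace G := IsTopologicalGroup.rightUniformSpace G

/-- The upper uniformity: the coarsest uniformity that is finer than the left and the right
uniformities (finer is smaller in Mathlib's order). -/
abbrev upperUnif : UniformSpace G := leftUnif G ⊓ rightUnif G

/-- The lower (Roelcke) uniformity: the finest uniformity that is coarser than the left and the
right uniformities (coarser is larger in Mathlib's order). -/
abbrev lowerUnif : UniformSpace G := leftUnif G ⊔ rightUnif G

theorem upper_le_left : upperUnif G ≤ leftUnif G := inf_le_left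

theorem upper_le_right : upperUnif G ≤ rightUnif G := inf_le_right

theorem left_le_lower : leftUnif G ≤ lowerUnif G := le_sup_left

theorem right_le_lower : rightUnif G ≤ lowerUnif G := le_sup_right

theorem upper_le_lower : upperUnif G ≤ lowerUnif G := inf_le_left.trans le_sup_left

end Uniformities

end

/-!
Uniform measures can be recognized by tightness: a functional `m` on `Ub X` belongs to `UMeas X` if
and only if, for every entourage `E`, it is arbitrarily small on the unit ball of the functions that
vanish on the `E`-balls around suitable finitely many points (`isTight_of_mem_UMeas`,
`mem_UMeas_of_isTight`). This holds for signed functionals too, since a function `g` that almost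
attains the norm of `m` turns `ψ ↦ m (g * ψ)` into a substitute for the total variation of `m`
(`abs_apply_le_of_dualNorm_sub_le`).

The identity maps of the theorem need not be uniform embeddings, but they are locally inducing
(`IsLocallyInducing`): on the translates of a fixed neighbourhood of the identity the finer
uniformity is refined by the coarser one, with an entourage that depends on the translate, because
conjugation by a fixed element is continuous. A finite number of translates can be served at the
same time, and tight functionals do not see more. Infimal convolutions with pseudometrics then
approximate a ueb set for the finer uniformity by ueb sets for the coarser one, near finitely many
points, with an error elsewhere that is controlled by a function of the coarser space
(`IsLocallyInducing.exists_isUeb_approx`). This gives injectivity, and, as positivity carries the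
control over to the approximating functionals, the embedding of the positive cones.

For the intersection formula, a functional `ν` on `Ub Y` is the image of a uniform measure under a
locally inducing surjection `X → Y` if and only if it is tight with respect to the balls of `X`; the
measure is any norm-preserving extension of `ν` (`IsLocallyInducing.exists_map_eq_of_isTight`). A
functional on the lower space that is tight for the left balls and for the right balls is tight for
the balls of the upper uniformity (`IsTight.inf`).
-/

open Filter Set Uniformity

/-! ### Uniformly continuous pseudometrics -/

/-- A uniformly continuous pseudometric with values at most `1` on a uniform space `X`, as an
unbundled function, so that many of them can be used on the same space. -/
structure IsUnifPseudo {X : Type*} [UniformSpace X] (d : X → X → ℝ) : Prop where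
  self : ∀ x, d x x = 0
  symm : ∀ x y, d x y = d y x
  triangle : ∀ x y z, d x z ≤ d x y + d y z
  le_one : ∀ x y, d x y ≤ 1
  unif : ∀ ε > 0, ∀ᶠ p in 𝓤 X, d p.1 p.2 < ε

theorem IsUnifPseudo.nonneg {X : Type*} [UniformSpace X] {d : X → X → ℝ} (hd : IsUnifPseudo d)
    (x y : X) : 0 ≤ d x y := by
  have h1 := hd.triangle x y x
  rw [hd.self, hd.symm y x] at h1
  linarith

/-- Every entourage contains the open unit tube of a uniformly continuous pseudometric: it
belongs to a coarser uniformity with a countable base, and such a uniformity is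
pseudometrizable. -/
theorem exists_isUnifPseudo {X : Type*} [UniformSpace X] {E : Set (X × X)} (hE : E ∈ 𝓤 X) :
    ∃ d : X → X → ℝ, IsUnifPseudo d ∧ ∀ x y, d x y < 1 → (x, y) ∈ E := by
  have step : ∀ V : {V : SetRel X X // V ∈ 𝓤 X}, ∃ W : {V : SetRel X X // V ∈ 𝓤 X},
      W.1.IsSymm ∧ SetRel.comp W.1 W.1 ⊆ V.1 := fun V => by
    obtain ⟨W, hW, hs, hc⟩ := comp_symm_mem_uniformity_sets V.2
    exact ⟨⟨W, hW⟩, hs, hc⟩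
  choose next hsymm hcomp using step
  let V : ℕ → {V : SetRel X X // V ∈ 𝓤 X} := fun n => next^[n] ⟨E, hE⟩
  have hV : ∀ n, V (n + 1) = next (V n) := fun n => Function.iterate_succ_apply' _ _ _
  have hVrefl : ∀ n x, (x, x) ∈ (V n).1 := fun n x => refl_mem_uniformity (V n).2
  have hVle : ∀ n, (V (n + 1)).1 ⊆ (V n).1 := fun n p hp => by
    have := hcomp (V n)
    rw [← hV] at this
    exact this ⟨p.1, hVrefl _ _, hp⟩
  have hanti : Antitone fun n => (V n).1 := antitone_nat_of_succ_le hVle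
  have hbasis : (⨅ n, 𝓟 (V n).1).HasBasis (fun _ : ℕ => True) fun n => (V n).1 :=
    hasBasis_iInf_principal hanti.directed_ge
  let c : UniformSpace.Core X := UniformSpace.Core.mk' (⨅ n, 𝓟 (V n).1)
    (fun r hr x => by
      obtain ⟨n, -, hn⟩ := hbasis.mem_iff.1 hr
      exact hn (hVrefl n x))
    (fun r hr => by
      obtain ⟨n, -, hn⟩ := hbasis.mem_iff.1 hr
      refine hbasis.mem_iff.2 ⟨n + 1, trivial, fun p hp => hn ?_⟩
      have h := hsymm (V n)
      rw [← hV] at h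
      exact hVle n (h.symm _ _ hp))
    (fun r hr => by
      obtain ⟨n, -, hn⟩ := hbasis.mem_iff.1 hr
      refine ⟨(V (n + 1)).1, hbasis.mem_of_mem trivial, Subset.trans ?_ hn⟩
      rw [hV]
      exact hcomp _)
  have hle : 𝓤 X ≤ c.uniformity := le_iInf fun n => le_principal_iff.2 (V n).2
  have hEc : E ∈ c.uniformity := hbasis.mem_of_mem (i := 0) trivial
  have hgen : c.uniformity.IsCountablyGenerated :=
    HasBasis.isCountablyGenerated hbasis
  clear_value c
  obtain ⟨I, hI⟩ : ∃ I : PseudoMetricSpace X,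
      I.toUniformSpace.uniformity = c.uniformity := by
    let _ : UniformSpace X := UniformSpace.ofCore c
    have : IsCountablyGenerated (𝓤 X) := hgen
    obtain ⟨I, hI⟩ := UniformSpace.metrizable_uniformity X
    exact ⟨I, congrArg (fun u : UniformSpace X => u.uniformity) hI⟩
  rw [← hI] at hle hEc
  obtain ⟨ε, hε, hεE⟩ := (@Metric.mem_uniformity_dist X I _).1 hEc
  refine ⟨fun x y => min 1 (ε⁻¹ * I.dist x y), ⟨fun x => ?_, fun x y => ?_, fun x y z => ?_,
    fun x y => min_le_left _ _, fun δ hδ => ?_⟩, fun x y h => hεE ?_⟩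
  · rw [show I.dist x x = 0 from dist_self x]
    simp
  · rw [show I.dist x y = I.dist y x from dist_comm x y]
  · have h1 : I.dist x z ≤ I.dist x y + I.dist y z := dist_triangle x y z
    have h2 : 0 ≤ ε⁻¹ * I.dist x y := mul_nonneg (by positivity) dist_nonneg
    have h3 : 0 ≤ ε⁻¹ * I.dist y z := mul_nonneg (by positivity) dist_nonneg
    have h4 : ε⁻¹ * I.dist x z ≤ ε⁻¹ * I.dist x y + ε⁻¹ * I.dist y z := by
      rw [← mul_add]
      gcongr
    rcases le_total 1 (ε⁻¹ * I.dist x y) with h | h <;>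
      rcases le_total 1 (ε⁻¹ * I.dist y z) with h' | h' <;>
      simp only [h, h', min_eq_left, min_eq_right] <;>
      first
        | exact (min_le_right _ _).trans h4
        | exact (min_le_left _ _).trans (by linarith)
  · have h1 := hle (@Metric.dist_mem_uniformity X I (ε * δ) (by positivity))
    filter_upwards [h1] with p hp
    refine (min_le_right _ _).trans_lt ?_
    rw [inv_mul_lt_iff₀ hε]
    exact hp
  · have h1 := (min_lt_iff.1 h).resolve_left (lt_irrefl _)
    rwa [inv_mul_lt_iff₀ hε, mul_one] at h1

/-! ### Bounded uniformly continuous functions -/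

namespace Ub

variable {X : Type*} [UniformSpace X]

theorem uniformContinuous_iff_eventually {f : X → ℝ} :
    UniformContinuous f ↔ ∀ ε > 0, ∀ᶠ p in 𝓤 X, |f p.1 - f p.2| < ε :=
  Metric.uniformity_basis_dist.tendsto_right_iff

/-- The element of `Ub X` given by a function that is uniformly continuous and bounded. -/
noncomputable def ofBounded (f : X → ℝ) (hf : ∀ ε > 0, ∀ᶠ p in 𝓤 X, |f p.1 - f p.2| < ε) (C : ℝ)
    (hC : ∀ x, |f x| ≤ C) : Ub X :=
  ⟨BoundedContinuousFunction.ofNormedAddCommGroup f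
    (uniformContinuous_iff_eventually.2 hf).continuous C hC, uniformContinuous_iff_eventually.2 hf⟩

theorem eventually_lt (f : Ub X) : ∀ ε > 0, ∀ᶠ p in 𝓤 X, |f.1 p.1 - f.1 p.2| < ε :=
  uniformContinuous_iff_eventually.1 f.2

theorem abs_apply_le (f : Ub X) (x : X) : |f.1 x| ≤ ‖f‖ := f.1.norm_coe_le_norm x

theorem norm_le_iff {f : Ub X} {C : ℝ} (hC : 0 ≤ C) : ‖f‖ ≤ C ↔ ∀ x, |f.1 x| ≤ C :=
  BoundedContinuousFunction.norm_le hC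

@[ext]
theorem ext {f g : Ub X} (h : ∀ x, f.1 x = g.1 x) : f = g :=
  Subtype.ext (BoundedContinuousFunction.ext h)

@[simp]
theorem add_apply (f g : Ub X) (x : X) : (f + g).1 x = f.1 x + g.1 x := rfl

@[simp]
theorem sub_apply (f g : Ub X) (x : X) : (f - g).1 x = f.1 x - g.1 x := rfl

@[simp]
theorem neg_apply (f : Ub X) (x : X) : (-f).1 x = -f.1 x := rfl

@[simp]
theorem zero_apply (x : X) : (0 : Ub X).1 x = 0 := rfl

@[simp]
theorem smul_apply (c : ℝ) (f : Ub X) (x : X) : (c • f).1 x = c * f.1 x := rfl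

theorem sum_apply {ι : Type*} (s : Finset ι) (f : ι → Ub X) (x : X) :
    (∑ i ∈ s, f i).1 x = ∑ i ∈ s, (f i).1 x := by
  classical
  induction s using Finset.induction_on with
  | empty => rfl
  | insert a s ha ih => rw [Finset.sum_insert ha, Finset.sum_insert ha, add_apply, ih]

/-- The constant function `1`. -/
noncomputable def one : Ub X :=
  ofBounded (fun _ => 1) (fun ε hε => by simpa using Eventually.of_forall fun _ => hε) 1 (by simp)

@[simp]
theorem one_apply (x : X) : (one : Ub X).1 x = 1 := rfl

theorem abs_mul_sub_mul_le (f g : Ub X) (x y : X) :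
    |f.1 x * g.1 x - f.1 y * g.1 y| ≤
      ‖f‖ * |g.1 x - g.1 y| + ‖g‖ * |f.1 x - f.1 y| := by
  have h : f.1 x * g.1 x - f.1 y * g.1 y =
    f.1 x * (g.1 x - g.1 y) + g.1 y * (f.1 x - f.1 y) := by ring
  rw [h]
  refine (abs_add_le _ _).trans ?_
  rw [abs_mul, abs_mul]
  gcongr <;> exact abs_apply_le _ _

/-- The pointwise product. -/
noncomputable def mul (f g : Ub X) : Ub X :=
  ofBounded (fun x => f.1 x * g.1 x)
    (fun ε hε => by
      have hM : 0 < ‖f‖ + ‖g‖ + 1 := by positivity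
      filter_upwards [Ub.eventually_lt f _ (div_pos hε hM), Ub.eventually_lt g _ (div_pos hε hM)]
        with p h1 h2
      have h3 : ‖f‖ * |g.1 p.1 - g.1 p.2| + ‖g‖ * |f.1 p.1 - f.1 p.2| ≤
          ‖f‖ * (ε / (‖f‖ + ‖g‖ + 1)) + ‖g‖ * (ε / (‖f‖ + ‖g‖ + 1)) := by gcongr
      have h4 : ‖f‖ * (ε / (‖f‖ + ‖g‖ + 1)) + ‖g‖ * (ε / (‖f‖ + ‖g‖ + 1)) < ε := by
        rw [← add_mul, ← mul_div_assoc, div_lt_iff₀ hM]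
        nlinarith
      exact (abs_mul_sub_mul_le f g _ _).trans_lt (h3.trans_lt h4))
    (‖f‖ * ‖g‖)
    (fun x => by rw [abs_mul]; gcongr <;> exact abs_apply_le _ _)

@[simp]
theorem mul_apply (f g : Ub X) (x : X) : (mul f g).1 x = f.1 x * g.1 x := rfl

/-- Truncation of a function to values in `[-δ, δ]`. -/
noncomputable def clamp (δ : ℝ) (hδ : 0 ≤ δ) (f : Ub X) : Ub X :=
  ofBounded (fun x => max (-δ) (min δ (f.1 x)))
    (fun ε hε => by
      filter_upwards [Ub.eventually_lt f ε hε] with p hp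
      refine lt_of_le_of_lt ?_ hp
      refine (abs_max_sub_max_le_max _ _ _ _).trans (max_le (by simp) ?_)
      exact (abs_min_sub_min_le_max _ _ _ _).trans (max_le (by simp) le_rfl))
    δ (fun x => abs_le.2 ⟨le_max_left _ _, max_le (by linarith) (min_le_left _ _)⟩)

theorem clamp_apply (δ : ℝ) (hδ : 0 ≤ δ) (f : Ub X) (x : X) :
    (clamp δ hδ f).1 x = max (-δ) (min δ (f.1 x)) := rfl

end Ub

/-! ### Ueb sets -/

section Ueb

variable {X : Type*} [UniformSpace X]

theorem isUeb_iff {H : Set (Ub X)} :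
    IsUeb H ↔ (∀ ε > 0, ∀ᶠ p in 𝓤 X, ∀ f ∈ H, |f.1 p.1 - f.1 p.2| < ε) ∧
      ∃ C, 0 ≤ C ∧ ∀ f ∈ H, ∀ x, |f.1 x| ≤ C := by
  refine and_congr ?_ ?_
  · constructor
    · intro h ε hε
      filter_upwards [h _ (Metric.dist_mem_uniformity hε)] with p hp f hf
      exact hp ⟨f, hf⟩
    · intro h U hU
      obtain ⟨ε, hε, hεU⟩ := Metric.mem_uniformity_dist.1 hU
      filter_upwards [h ε hε] with p hp f
      exact hεU (hp f.1 f.2)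
  · constructor
    · rintro ⟨C, hC⟩
      exact ⟨max C 0, le_max_right _ _, fun f hf x =>
        (Ub.abs_apply_le f x).trans ((hC f hf).trans (le_max_left _ _))⟩
    · rintro ⟨C, h0, hC⟩
      exact ⟨C, fun f hf => (Ub.norm_le_iff h0).2 (hC f hf)⟩

theorem IsUeb.union {H K : Set (Ub X)} (hH : IsUeb H) (hK : IsUeb K) : IsUeb (H ∪ K) := by
  rw [isUeb_iff] at hH hK ⊢
  obtain ⟨h1, C, hC, h2⟩ := hH
  obtain ⟨k1, D, hD, k2⟩ := hK
  refine ⟨fun ε hε => ?_, max C D, hC.trans (le_max_left _ _), ?_⟩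
  · filter_upwards [h1 ε hε, k1 ε hε] with p hp kp f hf
    exact hf.elim (hp f) (kp f)
  · rintro f (hf | hf) x
    · exact (h2 f hf x).trans (le_max_left _ _)
    · exact (k2 f hf x).trans (le_max_right _ _)

theorem IsUeb.mul_left (g : Ub X) {H : Set (Ub X)} (hH : IsUeb H) :
    IsUeb (Ub.mul g '' H) := by
  rw [isUeb_iff] at hH ⊢
  obtain ⟨h1, C, hC, h2⟩ := hH
  refine ⟨fun ε hε => ?_, ‖g‖ * C, by positivity, ?_⟩
  · have hM : 0 < ‖g‖ + C + 1 := by positivity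
    filter_upwards [Ub.eventually_lt g _ (div_pos hε hM), h1 _ (div_pos hε hM)] with p hg hp
    rintro _ ⟨f, hf, rfl⟩
    have hfC : ‖f‖ ≤ C := (Ub.norm_le_iff hC).2 (h2 f hf)
    have h3 : ‖g‖ * |f.1 p.1 - f.1 p.2| + ‖f‖ * |g.1 p.1 - g.1 p.2| ≤
        ‖g‖ * (ε / (‖g‖ + C + 1)) + C * (ε / (‖g‖ + C + 1)) := by
      have := (hp f hf).le
      gcongr
    have h4 : ‖g‖ * (ε / (‖g‖ + C + 1)) + C * (ε / (‖g‖ + C + 1)) < ε := by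
      rw [← add_mul, ← mul_div_assoc, div_lt_iff₀ hM]
      nlinarith
    exact (Ub.abs_mul_sub_mul_le g f _ _).trans_lt (h3.trans_lt h4)
  · rintro _ ⟨f, hf, rfl⟩ x
    rw [Ub.mul_apply, abs_mul]
    gcongr
    · exact Ub.abs_apply_le g x
    · exact h2 f hf x

/-- A bounded set of functions that are Lipschitz, with a common constant, for a uniformly
continuous pseudometric is a ueb set. -/
theorem IsUeb.of_lipschitz {d : X → X → ℝ} (hd : IsUnifPseudo d) {H : Set (Ub X)} {C D : ℝ}
    (hC : 0 ≤ C) (hD : 0 ≤ D) (h1 : ∀ f ∈ H, ∀ x y, f.1 x - f.1 y ≤ C * d x y)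
    (h2 : ∀ f ∈ H, ∀ x, |f.1 x| ≤ D) : IsUeb H := by
  refine isUeb_iff.2 ⟨fun ε hε => ?_, D, hD, h2⟩
  filter_upwards [hd.unif (ε / (C + 1)) (by positivity)] with p hp f hf
  have h3 : C * d p.1 p.2 < ε := by
    rw [lt_div_iff₀ (by positivity)] at hp
    nlinarith [hd.nonneg p.1 p.2]
  have h4 := h1 f hf p.1 p.2
  have h5 := h1 f hf p.2 p.1
  rw [hd.symm] at h5
  exact abs_lt.2 ⟨by linarith, by linarith⟩

end Ueb

/-! ### Infimal convolutions -/

section InfConv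

/-- The infimal convolution of `g : X → ℝ` with a multiple of a pseudometric `d`, along a map
`φ : X → Y`: the function `y ↦ inf_z (g z + c * d (φ z) y)` on `Y`. -/
noncomputable def infConv {X Y : Type*} (φ : X → Y) (d : Y → Y → ℝ) (c : ℝ) (g : X → ℝ)
    (y : Y) : ℝ :=
  ⨅ z, (g z + c * d (φ z) y)

theorem le_infConv {X Y : Type*} [Nonempty X] {φ : X → Y} {d : Y → Y → ℝ} {c a : ℝ} {g : X → ℝ}
    {y : Y} (h : ∀ z, a ≤ g z + c * d (φ z) y) : a ≤ infConv φ d c g y := le_ciInf h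

variable {X Y : Type*} [UniformSpace Y] {φ : X → Y} {d : Y → Y → ℝ} {c a b : ℝ} {g : X → ℝ}

theorem infConv_le (hd : IsUnifPseudo d) (hc : 0 ≤ c) (hg : ∀ z, a ≤ g z) (z : X) (y : Y) :
    infConv φ d c g y ≤ g z + c * d (φ z) y := by
  refine ciInf_le ⟨a, ?_⟩ z
  rintro _ ⟨w, rfl⟩
  have := mul_nonneg hc (hd.nonneg (φ w) y)
  linarith [hg w]

theorem infConv_map_le (hd : IsUnifPseudo d) (hc : 0 ≤ c) (hg : ∀ z, a ≤ g z) (z : X) :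
    infConv φ d c g (φ z) ≤ g z := by
  simpa [hd.self] using infConv_le (φ := φ) hd hc hg z (φ z)

theorem infConv_sub_le [Nonempty X] (hd : IsUnifPseudo d) (hc : 0 ≤ c) (hg : ∀ z, a ≤ g z)
    (x y : Y) : infConv φ d c g x - infConv φ d c g y ≤ c * d x y := by
  have h : infConv φ d c g x - c * d x y ≤ infConv φ d c g y := by
    refine le_infConv fun z => ?_
    have h1 := infConv_le (φ := φ) hd hc hg z x
    have h2 := mul_le_mul_of_nonneg_left (hd.triangle (φ z) y x) hc
    rw [hd.symm y x] at h2
    linarith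
  linarith

theorem abs_infConv_le [Nonempty X] (hd : IsUnifPseudo d) (hc : 0 ≤ c) (hg : ∀ z, |g z| ≤ b)
    (y : Y) : |infConv φ d c g y| ≤ b + c := by
  have hg0 : ∀ z, -b ≤ g z := fun z => (abs_le.1 (hg z)).1
  obtain ⟨z⟩ := ‹Nonempty X›
  refine abs_le.2 ⟨le_trans (by linarith) (le_infConv (a := -b) fun w => ?_), ?_⟩
  · have := mul_nonneg hc (hd.nonneg (φ w) y)
    linarith [hg0 w]
  · have h1 := infConv_le (φ := φ) hd hc hg0 z y
    have h2 := mul_le_mul_of_nonneg_left (hd.le_one (φ z) y) hc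
    linarith [(abs_le.1 (hg z)).2]

/-- The infimal convolutions of uniformly bounded functions form a ueb set. -/
theorem exists_isUeb_infConv [Nonempty X] (φ : X → Y) (hd : IsUnifPseudo d) (hc : 0 ≤ c)
    (hb : 0 ≤ b) : ∃ H : Set (Ub Y), IsUeb H ∧
      ∀ g : X → ℝ, (∀ z, |g z| ≤ b) → ∃ f ∈ H, ∀ y, f.1 y = infConv φ d c g y := by
  refine ⟨{f | ∃ g : X → ℝ, (∀ z, |g z| ≤ b) ∧ ∀ y, f.1 y = infConv φ d c g y}, ?_, ?_⟩
  · refine IsUeb.of_lipschitz hd hc (add_nonneg hb hc) ?_ ?_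
    · rintro f ⟨g, hg, hf⟩ x y
      rw [hf, hf]
      exact infConv_sub_le hd hc (fun z => (abs_le.1 (hg z)).1) x y
    · rintro f ⟨g, hg, hf⟩ x
      rw [hf]
      exact abs_infConv_le hd hc hg x
  · intro g hg
    refine ⟨Ub.ofBounded (infConv φ d c g) (fun ε hε => ?_) (b + c)
      (abs_infConv_le hd hc hg), ⟨g, hg, fun _ => rfl⟩, fun _ => rfl⟩
    have hg0 : ∀ z, -b ≤ g z := fun z => (abs_le.1 (hg z)).1
    filter_upwards [hd.unif (ε / (c + 1)) (by positivity)] with p hp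
    have h3 : c * d p.1 p.2 < ε := by
      rw [lt_div_iff₀ (by positivity)] at hp
      nlinarith [hd.nonneg p.1 p.2]
    have h4 := infConv_sub_le (φ := φ) hd hc hg0 p.1 p.2
    have h5 := infConv_sub_le (φ := φ) hd hc hg0 p.2 p.1
    rw [hd.symm] at h5
    exact abs_lt.2 ⟨by linarith, by linarith⟩

/-- For an entourage `F` there is a ueb set of functions with values in `[0, 1]` that separate
every set `A` from the complement of its `F`-neighbourhood. -/
theorem exists_isUeb_bump [Nonempty Y] {F : Set (Y × Y)} (hF : F ∈ 𝓤 Y) :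
    ∃ B : Set (Ub Y), IsUeb B ∧ ∀ A : Set Y, ∃ ψ ∈ B, (∀ y, 0 ≤ ψ.1 y) ∧ (∀ y, ψ.1 y ≤ 1) ∧
      (∀ y ∈ A, ψ.1 y = 0) ∧ ∀ y, ψ.1 y < 1 → ∃ a ∈ A, (a, y) ∈ F := by
  classical
  obtain ⟨d, hd, hdF⟩ := exists_isUnifPseudo hF
  obtain ⟨B, hB, hex⟩ := exists_isUeb_infConv (X := Y) id hd zero_le_one zero_le_one
  refine ⟨B, hB, fun A => ?_⟩
  have hχ0 : ∀ z, 0 ≤ (Aᶜ.indicator 1 z : ℝ) := fun z => indicator_nonneg (by simp) z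
  have hχ1 : ∀ z, (Aᶜ.indicator 1 z : ℝ) ≤ 1 := fun z =>
    indicator_le_self' (f := (1 : Y → ℝ)) (by simp) z
  obtain ⟨ψ, hψB, hψ⟩ := hex (Aᶜ.indicator 1) fun z => by
    rw [abs_of_nonneg (hχ0 z)]
    exact hχ1 z
  have hψ0 : ∀ y, 0 ≤ ψ.1 y := fun y => by
    rw [hψ]
    refine le_infConv fun z => ?_
    have := hd.nonneg z y
    have := hχ0 z
    simp only [id]
    linarith
  have hψle : ∀ y, ψ.1 y ≤ Aᶜ.indicator 1 y := fun y => by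
    rw [hψ]
    exact infConv_map_le (φ := id) hd zero_le_one hχ0 y
  refine ⟨ψ, hψB, hψ0, fun y => (hψle y).trans (hχ1 y), fun y hy => ?_, fun y hy => ?_⟩
  · refine le_antisymm ((hψle y).trans_eq ?_) (hψ0 y)
    simp [hy]
  · rw [hψ] at hy
    obtain ⟨z, hz⟩ := exists_lt_of_ciInf_lt hy
    simp only [id, one_mul] at hz
    have hzA : z ∈ A := by
      by_contra hzA
      rw [indicator_of_mem (show z ∈ Aᶜ from hzA), Pi.one_apply] at hz
      linarith [hd.nonneg z y]
    refine ⟨z, hzA, hdF _ _ ?_⟩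
    linarith [hχ0 z]

end InfConv

/-! ### Functionals on `Ub X` -/

section Functionals

variable {X : Type*} [UniformSpace X]

/-- The dual norm of a functional, as a supremum over the unit ball of `Ub X`. -/
noncomputable def UbDual.dualNorm (m : UbDual X) : ℝ := sSup (m '' {f | ∀ x, |f.1 x| ≤ 1})

namespace UbDual

theorem apply_sub (m : UbDual X) (f g : Ub X) : m (f - g) = m f - m g := by
  have h : f - g = f + (-1 : ℝ) • g := Ub.ext fun x => by
    rw [Ub.sub_apply, Ub.add_apply, Ub.smul_apply]
    ring
  rw [h, map_add, map_smul, smul_eq_mul]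
  ring

theorem bddAbove_image (m : UbDual X) : BddAbove (m '' {f | ∀ x, |f.1 x| ≤ 1}) := by
  have hm : Continuous (fun f : Ub X => m f) := map_continuous m
  obtain ⟨δ, hδ, h⟩ := Metric.continuousAt_iff.1 (hm.continuousAt (x := 0)) 1 one_pos
  refine ⟨2 * δ⁻¹, ?_⟩
  rintro _ ⟨f, hf, rfl⟩
  have hf1 : ‖f‖ ≤ 1 := (Ub.norm_le_iff zero_le_one).2 hf
  have hn : ‖(δ / 2) • f‖ ≤ δ / 2 := by
    refine (Ub.norm_le_iff (by positivity)).2 fun x => ?_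
    rw [Ub.smul_apply, abs_mul, abs_of_pos (by positivity : 0 < δ / 2)]
    exact mul_le_of_le_one_right (by positivity) (hf x)
  have h1 : dist ((δ / 2) • f) 0 < δ := by
    refine lt_of_eq_of_lt (b := ‖(δ / 2) • f‖) (dist_zero_right ((δ / 2) • f).1) ?_
    linarith
  have h2 := h h1
  rw [map_zero, dist_zero_right, map_smul, smul_eq_mul, Real.norm_eq_abs] at h2
  have h3 := (le_abs_self _).trans h2.le
  rw [← div_eq_mul_inv, le_div_iff₀ hδ]
  linarith

theorem apply_le_dualNorm (m : UbDual X) {f : Ub X} (hf : ∀ x, |f.1 x| ≤ 1) :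
    m f ≤ m.dualNorm :=
  le_csSup m.bddAbove_image ⟨f, hf, rfl⟩

theorem dualNorm_nonneg (m : UbDual X) : 0 ≤ m.dualNorm := by
  have := m.apply_le_dualNorm (f := 0) fun x => by simp
  rwa [map_zero] at this

theorem abs_apply_le (m : UbDual X) {f : Ub X} {a : ℝ} (ha : 0 ≤ a) (hf : ∀ x, |f.1 x| ≤ a) :
    |m f| ≤ m.dualNorm * a := by
  have key : ∀ k : Ub X, (∀ x, |k.1 x| ≤ a) → m k ≤ m.dualNorm * a := fun k hk => by
    rcases ha.eq_or_lt with rfl | ha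
    · have h0 : k = 0 := Ub.ext fun x => abs_nonpos_iff.1 (hk x)
      rw [h0, map_zero, mul_zero]
    · have h1 := m.apply_le_dualNorm (f := a⁻¹ • k) fun x => by
        rw [Ub.smul_apply, abs_mul, abs_of_pos (inv_pos.2 ha), inv_mul_le_iff₀ ha, mul_one]
        exact hk x
      rwa [map_smul, smul_eq_mul, inv_mul_le_iff₀ ha, mul_comm] at h1
  refine abs_le'.2 ⟨key f hf, ?_⟩
  rw [← map_neg]
  exact key (-f) fun x => by rw [Ub.neg_apply, abs_neg]; exact hf x

theorem exists_dualNorm_sub_le_apply (m : UbDual X) {ε : ℝ} (hε : 0 < ε) :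
    ∃ g : Ub X, (∀ x, |g.1 x| ≤ 1) ∧ m.dualNorm - ε ≤ m g := by
  have hne : (m '' {f | ∀ x, |f.1 x| ≤ 1}).Nonempty := ⟨m 0, 0, fun x => by simp, rfl⟩
  obtain ⟨_, ⟨g, hg, rfl⟩, h⟩ := exists_lt_of_lt_csSup hne (sub_lt_self m.dualNorm hε)
  exact ⟨g, hg, h.le⟩

end UbDual

/-- If `g` almost attains the norm of `m`, then `ψ ↦ m (g * ψ)` almost computes the total variation
of `m` on `[0, 1]`-valued functions: it bounds `|m h|` for all `|h| ≤ ψ` at once. The reason is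
that `±h + g * (1 - ψ)` still has norm at most `1`. -/
theorem abs_apply_le_of_dualNorm_sub_le (m : UbDual X) {ε : ℝ} {g ψ h : Ub X}
    (hg : ∀ x, |g.1 x| ≤ 1) (hgm : m.dualNorm - ε ≤ m g) (hψ : ∀ x, ψ.1 x ≤ 1)
    (hh : ∀ x, |h.1 x| ≤ ψ.1 x) : |m h| ≤ m (Ub.mul g ψ) + ε := by
  have key : ∀ k : Ub X, (∀ x, |k.1 x| ≤ ψ.1 x) → m k ≤ m (Ub.mul g ψ) + ε := by
    intro k hk
    have h1 : ∀ x, |(k + g - Ub.mul g ψ).1 x| ≤ 1 := fun x => by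
      rw [Ub.sub_apply, Ub.add_apply, Ub.mul_apply]
      have h2 : |g.1 x * (1 - ψ.1 x)| ≤ 1 - ψ.1 x := by
        rw [abs_mul, abs_of_nonneg (sub_nonneg.2 (hψ x))]
        exact mul_le_of_le_one_left (sub_nonneg.2 (hψ x)) (hg x)
      have h3 := abs_add_le (k.1 x) (g.1 x * (1 - ψ.1 x))
      rw [show k.1 x + g.1 x - g.1 x * ψ.1 x = k.1 x + g.1 x * (1 - ψ.1 x) by ring]
      linarith [hk x]
    have h2 := m.apply_le_dualNorm h1
    rw [m.apply_sub, map_add] at h2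
    linarith
  refine abs_le'.2 ⟨key h hh, ?_⟩
  rw [← map_neg]
  exact key (-h) fun x => by
    rw [Ub.neg_apply, abs_neg]
    exact hh x

/-- If `m` is small on the unit ball of the functions vanishing on `A`, then it is small on bounded
functions that are small on `A`. -/
theorem abs_apply_le_of_small_off (m : UbDual X) {A : Set X} {ε δ D : ℝ}
    (hA : ∀ h : Ub X, (∀ x, |h.1 x| ≤ 1) → (∀ x ∈ A, h.1 x = 0) → |m h| ≤ ε) (hδ : 0 ≤ δ)
    (hD : 0 < D) {r : Ub X} (h1 : ∀ x ∈ A, |r.1 x| ≤ δ) (h2 : ∀ x, |r.1 x| ≤ δ + D) :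
    |m r| ≤ m.dualNorm * δ + D * ε := by
  let c := Ub.clamp δ hδ r
  have hc : ∀ x, |c.1 x| ≤ δ := fun x => by
    rw [Ub.clamp_apply]
    exact abs_le.2 ⟨le_max_left _ _, max_le (by linarith) (min_le_left _ _)⟩
  have hr : r = c + D • (D⁻¹ • (r - c)) := by
    refine Ub.ext fun x => ?_
    rw [smul_smul, mul_inv_cancel₀ hD.ne', one_smul, Ub.add_apply, Ub.sub_apply]
    ring
  have h3 : |m (D⁻¹ • (r - c))| ≤ ε := by
    refine hA _ (fun x => ?_) fun x hx => ?_
    · rw [Ub.smul_apply, Ub.sub_apply, Ub.clamp_apply, abs_mul, abs_of_pos (inv_pos.2 hD),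
        inv_mul_le_iff₀ hD, mul_one]
      have h4 := abs_le.1 (h2 x)
      rcases le_total (r.1 x) δ with h5 | h5
      · rw [min_eq_right h5]
        rcases le_total (r.1 x) (-δ) with h6 | h6
        · rw [max_eq_left h6]
          exact abs_le.2 ⟨by linarith, by linarith⟩
        · rw [max_eq_right h6, sub_self, abs_zero]
          exact hD.le
      · rw [min_eq_left h5, max_eq_right (by linarith)]
        exact abs_le.2 ⟨by linarith, by linarith⟩
    · have h4 := abs_le.1 (h1 x hx)
      rw [Ub.smul_apply, Ub.sub_apply, Ub.clamp_apply, min_eq_right h4.2, max_eq_right h4.1,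
        sub_self, mul_zero]
  have hmr : m r = m c + D * m (D⁻¹ • (r - c)) := by
    conv_lhs => rw [hr, map_add, map_smul, smul_eq_mul]
  rw [hmr]
  refine (abs_add_le _ _).trans (add_le_add (m.abs_apply_le hδ hc) ?_)
  rw [abs_mul, abs_of_pos hD]
  exact mul_le_mul_of_nonneg_left h3 hD.le

/-- A functional on `Ub X` is a uniform measure if and only if it can be approximated by molecular
measures, uniformly on each ueb set. -/
theorem mem_UMeas_iff {m : UbDual X} :
    m ∈ UMeas X ↔ ∀ H : Set (Ub X), IsUeb H → ∀ ε > 0, ∃ m' ∈ Mol X, ∀ f ∈ H,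
      |m f - m' f| < ε := by
  have hb := UniformConvergenceCLM.hasBasis_nhds_zero_of_basis (RingHom.id ℝ) (E := Ub X) ℝ
    {H | IsUeb H} ⟨{0}, isUeb_singleton 0⟩
    (fun H hH K hK => ⟨H ∪ K, hH.union hK, subset_union_left, subset_union_right⟩)
    (Metric.nhds_basis_ball (x := (0 : ℝ)))
  have hb2 := hb.map (fun k => m + k)
  rw [map_add_left_nhds_zero] at hb2
  change m ∈ closure (Mol X : Set (UbDual X)) ↔ _
  rw [mem_closure_iff_nhds_basis hb2]
  constructor
  · intro h H hH ε hε
    obtain ⟨_, hm', k, hk, rfl⟩ := h (H, ε) ⟨hH, hε⟩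
    refine ⟨_, hm', fun f hf => ?_⟩
    have h1 := hk f hf
    rw [mem_ball_zero_iff, Real.norm_eq_abs] at h1
    rw [show (m + k) f = m f + k f from rfl, sub_add_cancel_left, abs_neg]
    exact h1
  · rintro h ⟨H, ε⟩ ⟨hH, hε⟩
    obtain ⟨m', hm', h1⟩ := h H hH ε hε
    refine ⟨m', hm', m' - m, fun f hf => ?_, add_sub_cancel _ _⟩
    rw [mem_ball_zero_iff, Real.norm_eq_abs, show (m' - m) f = m' f - m f from rfl, abs_sub_comm]
    exact h1 f hf

theorem exists_finset_of_mem_Mol {m : UbDual X} (hm : m ∈ Mol X) :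
    ∃ K : Finset X, ∀ f : Ub X, (∀ k ∈ K, f.1 k = 0) → m f = 0 := by
  classical
  induction hm using Submodule.span_induction with
  | mem m h =>
    obtain ⟨x, rfl⟩ := h
    exact ⟨{x}, fun f hf => hf x (by simp)⟩
  | zero => exact ⟨∅, fun f _ => rfl⟩
  | add a b _ _ iha ihb =>
    obtain ⟨K, hK⟩ := iha
    obtain ⟨L, hL⟩ := ihb
    refine ⟨K ∪ L, fun f hf => ?_⟩
    rw [show (a + b) f = a f + b f from rfl, hK f fun k hk => hf k (by simp [hk]),
      hL f fun k hk => hf k (by simp [hk]), add_zero]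
  | smul c a _ ih =>
    obtain ⟨K, hK⟩ := ih
    refine ⟨K, fun f hf => ?_⟩
    rw [show (c • a) f = c * a f from rfl, hK f hf, mul_zero]

theorem sum_smul_pointMass_mem_Mol (K : Finset X) (c : X → ℝ) :
    ∑ k ∈ K, c k • pointMass k ∈ Mol X :=
  Submodule.sum_mem _ fun k _ => Submodule.smul_mem _ _ (Submodule.subset_span ⟨k, rfl⟩)

theorem sum_smul_pointMass_apply (K : Finset X) (c : X → ℝ) (f : Ub X) :
    (∑ k ∈ K, c k • pointMass k : UbDual X) f = ∑ k ∈ K, c k * f.1 k := by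
  classical
  induction K using Finset.induction_on with
  | empty => rfl
  | insert a s ha ih =>
    rw [Finset.sum_insert ha, Finset.sum_insert ha, ← ih]
    rfl

end Functionals

/-! ### Tight functionals -/

/-- A functional `ν` on `Ub Y` is tight along a map `φ : X → Y` if for every entourage of `X` its
mass lies, up to an arbitrarily small error, in the image under `φ` of finitely many balls for this
entourage. The functions used as tests are uniformly continuous on `Y`, but the balls are those of
the uniformity of `X`. -/
def IsTight {X Y : Type*} [UniformSpace X] [UniformSpace Y] (φ : X → Y) (ν : Ub Y → ℝ) : Prop :=
  ∀ E ∈ 𝓤 X, ∀ ε > 0, ∃ K : Finset X, ∀ h : Ub Y, (∀ y, |h.1 y| ≤ 1) →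
    (∀ k ∈ K, ∀ x, (k, x) ∈ E → h.1 (φ x) = 0) → |ν h| ≤ ε

section Tight

variable {X Y : Type*} [UniformSpace X] [UniformSpace Y]

theorem IsTight.map {φ : X → Y} (hφ : UniformContinuous φ) {m : UbDual X} (hm : IsTight id m) :
    IsTight φ (UbDual.map φ hφ m) := by
  intro E hE ε hε
  obtain ⟨K, hK⟩ := hm E hE ε hε
  exact ⟨K, fun h h1 h2 => hK (Ub.comp φ hφ h) (fun x => h1 (φ x)) fun k hk x hx => h2 k hk x hx⟩

/-- A uniform measure is tight. A function `g` that almost attains the norm of `m` reduces the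
estimate for all test functions to the functions `g * ψ`, where `ψ` runs through a ueb set, and
on these `m` is close to a molecular measure. -/
theorem isTight_of_mem_UMeas [Nonempty X] {m : UbDual X} (hm : m ∈ UMeas X) : IsTight id m := by
  intro E hE ε hε
  obtain ⟨g, hg, hgm⟩ := m.exists_dualNorm_sub_le_apply (half_pos hε)
  obtain ⟨B, hB, hex⟩ := exists_isUeb_bump hE
  obtain ⟨m', hm', happ⟩ := mem_UMeas_iff.1 hm _ (hB.mul_left g) _ (half_pos hε)
  obtain ⟨K, hK⟩ := exists_finset_of_mem_Mol hm'
  refine ⟨K, fun h h1 h2 => ?_⟩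
  obtain ⟨ψ, hψB, hψ0, hψ1, hψK, hψE⟩ := hex (K : Set X)
  have hh : ∀ x, |h.1 x| ≤ ψ.1 x := fun x => by
    rcases lt_or_ge (ψ.1 x) 1 with hx | hx
    · obtain ⟨k, hk, hkx⟩ := hψE x hx
      have := h2 k hk x hkx
      rw [id] at this
      rw [this, abs_zero]
      exact hψ0 x
    · exact (h1 x).trans hx
  have h3 := abs_apply_le_of_dualNorm_sub_le m hg hgm hψ1 hh
  have h4 := happ _ ⟨ψ, hψB, rfl⟩
  rw [hK _ fun k hk => by rw [Ub.mul_apply, hψK k hk, mul_zero], sub_zero] at h4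
  have h5 := (le_abs_self _).trans h4.le
  linarith

/-- Partitions of unity subordinate to the balls of an entourage around finitely many points. -/
theorem exists_partition_of_unity [Nonempty X] {E : Set (X × X)} (hE : E ∈ 𝓤 X) :
    ∃ E' ∈ 𝓤 X, ∀ K : Finset X, ∃ p : X → Ub X, (∀ k x, 0 ≤ (p k).1 x) ∧
      (∀ x, ∑ k ∈ K, (p k).1 x ≤ 1) ∧
      (∀ k ∈ K, ∀ x, (k, x) ∈ E' → ∑ k ∈ K, (p k).1 x = 1) ∧
      ∀ k ∈ K, ∀ x, (p k).1 x ≠ 0 → (k, x) ∈ E := by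
  classical
  obtain ⟨E', hE', hcomp⟩ := comp_mem_uniformity_sets hE
  refine ⟨E', hE', fun K => ?_⟩
  obtain ⟨B, -, hex⟩ := exists_isUeb_bump hE'
  induction K using Finset.induction_on with
  | empty => exact ⟨fun _ => 0, by simp, by simp, by simp, by simp⟩
  | insert a K ha ih =>
    obtain ⟨p, hp0, hp1, hpK, hpE⟩ := ih
    obtain ⟨ψ, -, hψ0, hψ1, hψa, hψE⟩ := hex {x | (a, x) ∈ E'}
    -- `q` takes up the rest `1 - ∑ p k`, as far as it lies near the new point `a`
    let q : Ub X := Ub.mul (Ub.one - ∑ k ∈ K, p k) (Ub.one - ψ)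
    have hq : ∀ x, q.1 x = (1 - ∑ k ∈ K, (p k).1 x) * (1 - ψ.1 x) := fun x => by
      rw [Ub.mul_apply, Ub.sub_apply, Ub.sub_apply, Ub.sum_apply, Ub.one_apply]
    have hsum : ∀ x, ∑ k ∈ insert a K, (Function.update p a q k).1 x =
        q.1 x + ∑ k ∈ K, (p k).1 x := fun x => by
      rw [Finset.sum_insert ha, Function.update_self]
      congr 1
      refine Finset.sum_congr rfl fun k hk => ?_
      rw [Function.update_of_ne (ne_of_mem_of_not_mem hk ha)]
    have hq0 : ∀ x, 0 ≤ q.1 x := fun x => by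
      rw [hq]
      exact mul_nonneg (sub_nonneg.2 (hp1 x)) (sub_nonneg.2 (hψ1 x))
    refine ⟨Function.update p a q, fun k x => ?_, fun x => ?_, fun k hk x hx => ?_,
      fun k hk x hx => ?_⟩
    · rcases eq_or_ne k a with rfl | hka
      · rw [Function.update_self]
        exact hq0 x
      · rw [Function.update_of_ne hka]
        exact hp0 k x
    · rw [hsum, hq]
      nlinarith [hp1 x, hψ0 x]
    · rw [hsum, hq]
      rcases Finset.mem_insert.1 hk with rfl | hk
      · rw [hψa x hx]
        ring
      · rw [hpK k hk x hx]
        ring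
    · rcases eq_or_ne k a with rfl | hka
      · rw [Function.update_self, hq] at hx
        have h1 : ψ.1 x < 1 := lt_of_le_of_ne (hψ1 x) fun h => hx (by rw [h]; ring)
        obtain ⟨z, hz, hzx⟩ := hψE x h1
        exact hcomp ⟨z, hz, hzx⟩
      · rw [Function.update_of_ne hka] at hx
        exact hpE k ((Finset.mem_insert.1 hk).resolve_left hka) x hx

/-- A tight functional is a uniform measure: partitions of unity give molecular approximations. -/
theorem mem_UMeas_of_isTight [Nonempty X] {m : UbDual X} (hm : IsTight id m) : m ∈ UMeas X := by
  refine mem_UMeas_iff.2 fun H hH η hη => ?_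
  obtain ⟨hH1, C, hC, hHC⟩ := isUeb_iff.1 hH
  let δ := η / (m.dualNorm + 2 * C + 2)
  have hm0 := m.dualNorm_nonneg
  have hM : 0 < m.dualNorm + 2 * C + 2 := by positivity
  have hδ : 0 < δ := by positivity
  have hδη : m.dualNorm * δ + (2 * C + 1) * δ < η := by
    have : (m.dualNorm + 2 * C + 2) * δ = η := mul_div_cancel₀ _ hM.ne'
    nlinarith
  obtain ⟨E', hE', hpart⟩ := exists_partition_of_unity (hH1 δ hδ)
  obtain ⟨K, hK⟩ := hm E' hE' δ hδ
  obtain ⟨p, hp0, hp1, hpK, hpE⟩ := hpart K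
  refine ⟨_, sum_smul_pointMass_mem_Mol K fun k => m (p k), fun f hf => ?_⟩
  have hterm : ∀ k ∈ K, ∀ x, |f.1 x * (p k).1 x - f.1 k * (p k).1 x| ≤ δ * (p k).1 x := by
    intro k hk x
    rcases eq_or_ne ((p k).1 x) 0 with h0 | h0
    · simp [h0]
    · rw [← sub_mul, abs_mul, abs_of_nonneg (hp0 k x), abs_sub_comm]
      exact mul_le_mul_of_nonneg_right (hpE k hk x h0 f hf).le (hp0 k x)
  let r : Ub X := f - ∑ k ∈ K, f.1 k • p k
  have hr : ∀ x, r.1 x = f.1 x - ∑ k ∈ K, f.1 k * (p k).1 x := fun x => by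
    rw [Ub.sub_apply, Ub.sum_apply]
    rfl
  have hmr : m f - (∑ k ∈ K, m (p k) • pointMass k : UbDual X) f = m r := by
    rw [sum_smul_pointMass_apply, m.apply_sub, map_sum m]
    simp only [map_smul, smul_eq_mul, mul_comm]
  have hsum : ∀ x, |f.1 x * ∑ k ∈ K, (p k).1 x - ∑ k ∈ K, f.1 k * (p k).1 x| ≤ δ := fun x => by
    rw [Finset.mul_sum, ← Finset.sum_sub_distrib]
    refine (Finset.abs_sum_le_sum_abs _ _).trans ((Finset.sum_le_sum fun k hk =>
      hterm k hk x).trans ?_)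
    rw [← Finset.mul_sum]
    exact mul_le_of_le_one_right hδ.le (hp1 x)
  rw [hmr]
  refine lt_of_le_of_lt (abs_apply_le_of_small_off m (A := {x | ∃ k ∈ K, (k, x) ∈ E'})
    (fun h h1 h2 => hK h h1 fun k hk x hx => h2 x ⟨k, hk, hx⟩) hδ.le
    (by positivity : (0 : ℝ) < 2 * C + 1) ?_ ?_) hδη
  · rintro x ⟨k, hk, hx⟩
    have h1 := hsum x
    rw [hpK k hk x hx, mul_one] at h1
    rwa [hr]
  · intro x
    have h1 := abs_le.1 (hsum x)
    have h2 := abs_le.1 (hHC f hf x)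
    have h3 : |f.1 x * ∑ k ∈ K, (p k).1 x| ≤ C := by
      rw [abs_mul, abs_of_nonneg (Finset.sum_nonneg fun k _ => hp0 k x)]
      exact (mul_le_of_le_one_right (abs_nonneg _) (hp1 x)).trans (hHC f hf x)
    have h4 := abs_le.1 h3
    rw [hr]
    exact abs_le.2 ⟨by linarith, by linarith⟩

end Tight

/-! ### Locally inducing maps -/

/-- A map `φ : X → Y` is locally inducing if, for some entourage `E'` depending only on the
entourage `E`, on each `E'`-ball the entourage `E` is refined by the preimage of an entourage `F`
of `Y`. The entourage `F` may depend on the centre of the ball, so that this is much weaker than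
being a uniform embedding. -/
def IsLocallyInducing {X Y : Type*} [UniformSpace X] [UniformSpace Y] (φ : X → Y) : Prop :=
  ∀ E ∈ 𝓤 X, ∃ E' ∈ 𝓤 X, ∀ x, ∃ F ∈ 𝓤 Y, ∀ z y, (x, z) ∈ E' → (φ z, φ y) ∈ F → (z, y) ∈ E

section LocallyInducing

variable {X Y : Type*} [UniformSpace X] [UniformSpace Y] {φ : X → Y}

/-- The entourage `F` in the definition of a locally inducing map can be chosen to serve finitely
many balls at once. -/
theorem IsLocallyInducing.exists_finset (hφ : IsLocallyInducing φ) {E : Set (X × X)}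
    (hE : E ∈ 𝓤 X) : ∃ E' ∈ 𝓤 X, ∀ K : Finset X, ∃ F ∈ 𝓤 Y, ∀ k ∈ K, ∀ z y,
      (k, z) ∈ E' → (φ z, φ y) ∈ F → (z, y) ∈ E := by
  obtain ⟨E', hE', h⟩ := hφ E hE
  choose F hF hFE using h
  exact ⟨E', hE', fun K => ⟨⋂ k ∈ K, F k, (biInter_finset_mem K).2 fun k _ => hF k,
    fun k hk z y hz hy => hFE k z y hz (mem_iInter₂.1 hy k hk)⟩⟩

/-- Along a locally inducing map, functions that are uniformly continuous on the codomain separate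
small balls of the domain, taken around finitely many points, from the complement of larger ones. -/
theorem IsLocallyInducing.exists_bump [Nonempty Y] (hφ : IsLocallyInducing φ) {E : Set (X × X)}
    (hE : E ∈ 𝓤 X) : ∃ E' ∈ 𝓤 X, ∀ K : Finset X, ∃ ψ : Ub Y, (∀ y, 0 ≤ ψ.1 y) ∧
      (∀ y, ψ.1 y ≤ 1) ∧ (∀ k ∈ K, ∀ x, (k, x) ∈ E' → ψ.1 (φ x) = 0) ∧
      ∀ x, ψ.1 (φ x) < 1 → ∃ k ∈ K, (k, x) ∈ E := by
  obtain ⟨E₁, hE₁, hcomp⟩ := comp_mem_uniformity_sets hE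
  obtain ⟨E₂, hE₂, hF⟩ := hφ.exists_finset hE₁
  refine ⟨E₁ ∩ E₂, inter_mem hE₁ hE₂, fun K => ?_⟩
  obtain ⟨F, hF, hFE⟩ := hF K
  obtain ⟨B, -, hex⟩ := exists_isUeb_bump hF
  obtain ⟨ψ, -, hψ0, hψ1, hψA, hψF⟩ := hex (φ '' {z | ∃ k ∈ K, (k, z) ∈ E₁ ∩ E₂})
  refine ⟨ψ, hψ0, hψ1, fun k hk x hx => hψA _ ⟨x, ⟨k, hk, hx⟩, rfl⟩, fun x hx => ?_⟩
  obtain ⟨_, ⟨z, ⟨k, hk, hz⟩, rfl⟩, hzx⟩ := hψF _ hx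
  exact ⟨k, hk, hcomp ⟨z, hz.1, hFE k hk z x hz.2 hzx⟩⟩

/-- Along a locally inducing map `φ : X → Y` every ueb set on `X` is approximated by ueb sets on
`Y`: up to `ε` on balls of a fixed size around finitely many given points, and with a uniformly
bounded error, which is controlled by a function on `Y`, elsewhere. -/
theorem IsLocallyInducing.exists_isUeb_approx [Nonempty X] (hφ : IsLocallyInducing φ)
    {H : Set (Ub X)} (hH : IsUeb H) :
    ∃ C > 0, ∀ ε > 0, ∃ E ∈ 𝓤 X, ∀ K : Finset X, ∃ ψ : Ub Y, (∀ y, 0 ≤ ψ.1 y) ∧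
      (∀ y, ψ.1 y ≤ 1) ∧ (∀ k ∈ K, ∀ x, (k, x) ∈ E → ψ.1 (φ x) = 0) ∧
      ∃ H' : Set (Ub Y), IsUeb H' ∧ ∀ f ∈ H, ∃ f' ∈ H', ∀ x,
        |f.1 x - f'.1 (φ x)| ≤ ε + C * ψ.1 (φ x) := by
  have : Nonempty Y := ‹Nonempty X›.map φ
  obtain ⟨hH1, C, hC, hHC⟩ := isUeb_iff.1 hH
  refine ⟨2 * C + 1, by positivity, fun ε hε => ?_⟩
  obtain ⟨E', hE', hF⟩ := hφ.exists_finset (hH1 ε hε)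
  obtain ⟨E, hE, hψ⟩ := hφ.exists_bump hE'
  refine ⟨E, hE, fun K => ?_⟩
  obtain ⟨ψ, hψ0, hψ1, hψK, hψE⟩ := hψ K
  obtain ⟨F, hF, hFE⟩ := hF K
  obtain ⟨d, hd, hdF⟩ := exists_isUnifPseudo hF
  -- with slope `2 * C`, points at distance `1` from `φ x` are irrelevant for the infimum at `φ x`
  have hC2 : 0 ≤ 2 * C := by positivity
  obtain ⟨H', hH', hex⟩ := exists_isUeb_infConv φ hd hC2 hC
  refine ⟨ψ, hψ0, hψ1, hψK, H', hH', fun f hf => ?_⟩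
  obtain ⟨f', hf', hff'⟩ := hex f.1 (hHC f hf)
  have hfC : ∀ z, -C ≤ f.1 z := fun z => (abs_le.1 (hHC f hf z)).1
  refine ⟨f', hf', fun x => ?_⟩
  have hle : f'.1 (φ x) ≤ f.1 x := by
    rw [hff']
    exact infConv_map_le hd hC2 hfC x
  have hx := abs_le.1 (hHC f hf x)
  rw [abs_of_nonneg (sub_nonneg.2 hle)]
  have hψx := mul_nonneg (by positivity : 0 ≤ 2 * C + 1) (hψ0 (φ x))
  rcases lt_or_ge (ψ.1 (φ x)) 1 with h1 | h1
  · obtain ⟨k, hk, hkx⟩ := hψE x h1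
    have h2 : f.1 x - ε ≤ f'.1 (φ x) := by
      rw [hff']
      refine le_infConv fun z => ?_
      rcases lt_or_ge (d (φ z) (φ x)) 1 with h3 | h3
      · rw [hd.symm] at h3
        have h4 := (abs_lt.1 (hFE k hk x z hkx (hdF _ _ h3) f hf)).2
        have := mul_nonneg hC2 (hd.nonneg (φ z) (φ x))
        linarith
      · have h4 := mul_le_mul_of_nonneg_left h3 hC2
        linarith [hfC z]
    linarith
  · have h2 : -C ≤ f'.1 (φ x) := by
      rw [hff']
      refine le_infConv fun z => ?_
      have := mul_nonneg hC2 (hd.nonneg (φ z) (φ x))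
      linarith [hfC z]
    rw [le_antisymm (hψ1 (φ x)) h1]
    linarith

end LocallyInducing

/-! ### Injectivity and embedding of positive cones -/

section Embedding

variable {X Y : Type*} [UniformSpace X] [UniformSpace Y] {φ : X → Y}

theorem IsLocallyInducing.injective_map [Nonempty X] (hφ : IsLocallyInducing φ)
    (hu : UniformContinuous φ) : Function.Injective (UMeas.map φ hu) := by
  refine (injective_iff_map_eq_zero _).2 fun m hm => ?_
  have hm0 : ∀ f' : Ub Y, m.1 (Ub.comp φ hu f') = 0 := fun f' => by
    rw [← UMeas.map_apply, hm]
    rfl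
  refine Subtype.ext (UniformConvergenceCLM.ext _ _ fun f => ?_)
  change m.1 f = 0
  obtain ⟨C, hC, happ⟩ := hφ.exists_isUeb_approx (isUeb_singleton f)
  refine abs_nonpos_iff.1 (le_of_forall_pos_le_add fun η hη => ?_)
  have hM0 := m.1.dualNorm_nonneg
  have hM : 0 < m.1.dualNorm + C := by positivity
  obtain ⟨E, hE, hK⟩ := happ (η / (m.1.dualNorm + C)) (by positivity)
  obtain ⟨K, hKm⟩ := isTight_of_mem_UMeas m.2 E hE (η / (m.1.dualNorm + C)) (by positivity)
  obtain ⟨ψ, hψ0, hψ1, hψK, H', -, hH'⟩ := hK K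
  obtain ⟨f', -, hff'⟩ := hH' f rfl
  have h1 : m.1 f = m.1 (f - Ub.comp φ hu f') := by rw [m.1.apply_sub, hm0, sub_zero]
  have h2 := abs_apply_le_of_small_off m.1 (A := {x | ∃ k ∈ K, (k, x) ∈ E})
    (r := f - Ub.comp φ hu f') (fun h h1 h2 => hKm h h1 fun k hk x hx => h2 x ⟨k, hk, hx⟩)
    (by positivity : 0 ≤ η / (m.1.dualNorm + C)) hC
    (by
      rintro x ⟨k, hk, hx⟩
      have := hff' x
      rwa [hψK k hk x hx, mul_zero, add_zero] at this)
    (fun x => (hff' x).trans (by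
      have := mul_le_mul_of_nonneg_left (hψ1 (φ x)) hC.le
      linarith))
  rw [h1, zero_add]
  refine h2.trans_eq ?_
  field_simp

theorem abs_apply_le_of_nonneg {m : UbDual X} (hm : ∀ f : Ub X, (∀ x, 0 ≤ f.1 x) → 0 ≤ m f)
    {r s : Ub X} (h : ∀ x, |r.1 x| ≤ s.1 x) : |m r| ≤ m s := by
  have h1 := hm (s - r) fun x => by
    rw [Ub.sub_apply]
    linarith [(abs_le.1 (h x)).2]
  have h2 := hm (s + r) fun x => by
    rw [Ub.add_apply]
    linarith [(abs_le.1 (h x)).1]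
  rw [m.apply_sub] at h1
  rw [map_add] at h2
  exact abs_le.2 ⟨by linarith, by linarith⟩

/-- On the positive cone the topology is determined by the image topology: if the images of positive
functionals converge to the image of `μ`, then, since `μ` is concentrated near finitely many points,
positivity shows that the converging functionals are, eventually, concentrated there as well. -/
theorem IsLocallyInducing.isEmbedding_mapPos [Nonempty X] (hφ : IsLocallyInducing φ)
    (hu : UniformContinuous φ) : Topology.IsEmbedding (UMeas.mapPos φ hu) := by
  have hcont : Continuous (UMeas.mapPos φ hu) :=
    (UMeas.map φ hu).continuous.restrict (UMeas.map_mapsTo φ hu)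
  have hinj : Function.Injective (UMeas.mapPos φ hu) := fun a b hab =>
    Subtype.ext (hφ.injective_map hu (congrArg Subtype.val hab))
  refine ⟨Topology.isInducing_iff_nhds.2 fun μ => le_antisymm (hcont.tendsto μ).le_comap ?_, hinj⟩
  have hlim : Tendsto (fun ν : UMeasPos X => (UMeas.mapPos φ hu ν).1.1)
      (comap (UMeas.mapPos φ hu) (𝓝 (UMeas.mapPos φ hu μ))) (𝓝 (UMeas.mapPos φ hu μ).1.1) :=
    ((continuous_subtype_val.comp continuous_subtype_val).tendsto _).comp tendsto_comap
  have hlim2 := (UniformConvergenceCLM.tendsto_iff_tendstoUniformlyOn _ _ _).1 hlim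
  suffices h : Tendsto (fun ν : UMeasPos X => ν.1.1)
      (comap (UMeas.mapPos φ hu) (𝓝 (UMeas.mapPos φ hu μ))) (𝓝 μ.1.1) by
    have hnhds : 𝓝 μ = comap (fun ν : UMeasPos X => ν.1.1) (𝓝 μ.1.1) := by
      rw [nhds_subtype_eq_comap, nhds_subtype_eq_comap, comap_comap]
      rfl
    exact h.le_comap.trans_eq hnhds.symm
  refine (UniformConvergenceCLM.tendsto_iff_tendstoUniformlyOn _ _ _).2 fun H hH => ?_
  obtain ⟨C, hC, happ⟩ := hφ.exists_isUeb_approx hH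
  refine Metric.tendstoUniformlyOn_iff.2 fun η hη => ?_
  have h1pos : 0 ≤ μ.1.1 Ub.one := μ.2 _ fun x => zero_le_one
  -- the error will be at most `2 * μ 1 + 1` (from the constant part of the approximation), `3 * C`
  -- (from the part controlled by `ψ`) and `1` (from the test functions on `Y`), all times `ε`
  let ε := η / (2 * μ.1.1 Ub.one + 3 * C + 3)
  have hε : 0 < ε := by positivity
  have hεη : (2 * μ.1.1 Ub.one + 3 * C + 3) * ε = η :=
    mul_div_cancel₀ _ (by positivity)
  obtain ⟨E, hE, hK⟩ := happ ε hε
  obtain ⟨K, hKm⟩ := isTight_of_mem_UMeas μ.1.2 E hE ε hε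
  obtain ⟨ψ, hψ0, hψ1, hψK, H', hH', happ'⟩ := hK K
  have hψμ : μ.1.1 (Ub.comp φ hu ψ) ≤ ε := (le_abs_self _).trans <|
    hKm (Ub.comp φ hu ψ) (fun x => by
      rw [Ub.comp_apply, abs_of_nonneg (hψ0 _)]
      exact hψ1 _) hψK
  filter_upwards [Metric.tendstoUniformlyOn_iff.1 (hlim2 H' hH') ε hε,
    Metric.tendstoUniformlyOn_iff.1 (hlim2 {ψ} (isUeb_singleton ψ)) ε hε,
    Metric.tendstoUniformlyOn_iff.1 (hlim2 {Ub.one} (isUeb_singleton _)) 1 one_pos]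
    with ν hνH hνψ hν1 f hf
  obtain ⟨f', hf', hff'⟩ := happ' f hf
  replace hνH : |μ.1.1 (Ub.comp φ hu f') - ν.1.1 (Ub.comp φ hu f')| < ε := hνH f' hf'
  replace hνψ : |μ.1.1 (Ub.comp φ hu ψ) - ν.1.1 (Ub.comp φ hu ψ)| < ε := hνψ ψ rfl
  replace hν1 : |μ.1.1 Ub.one - ν.1.1 Ub.one| < 1 := hν1 Ub.one rfl
  have hdiff : ∀ x, |(f - Ub.comp φ hu f').1 x| ≤ (ε • Ub.one + C • Ub.comp φ hu ψ).1 x := by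
    intro x
    rw [Ub.add_apply, Ub.smul_apply, Ub.smul_apply, Ub.one_apply, mul_one]
    exact hff' x
  have hμd := abs_apply_le_of_nonneg μ.2 hdiff
  have hνd := abs_apply_le_of_nonneg ν.2 hdiff
  rw [UbDual.apply_sub, map_add, map_smul, map_smul, smul_eq_mul, smul_eq_mul] at hμd hνd
  have e1 : C * μ.1.1 (Ub.comp φ hu ψ) ≤ C * ε := mul_le_mul_of_nonneg_left hψμ hC.le
  have e2 : C * ν.1.1 (Ub.comp φ hu ψ) ≤ C * (2 * ε) :=
    mul_le_mul_of_nonneg_left (by linarith [(abs_lt.1 hνψ).1]) hC.le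
  have e3 : ε * ν.1.1 Ub.one ≤ ε * (μ.1.1 Ub.one + 1) :=
    mul_le_mul_of_nonneg_left (by linarith [(abs_lt.1 hν1).1]) hε.le
  rw [Real.dist_eq]
  have a1 := abs_le.1 hμd
  have a2 := abs_le.1 hνd
  have a3 := abs_lt.1 hνH
  exact abs_lt.2 ⟨by nlinarith, by nlinarith⟩

end Embedding

/-! ### Lifting tight functionals -/

section Lifting

variable {X Y : Type*} [UniformSpace X] [UniformSpace Y] {φ : X → Y}

/-- Hahn–Banach extension of functionals along `f ↦ f ∘ φ`, without increase of the norm. -/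
theorem exists_map_eq_of_surjective (hu : UniformContinuous φ) (hs : Function.Surjective φ)
    (ν : UbDual Y) : ∃ m : UbDual X, UbDual.map φ hu m = ν ∧ m.dualNorm ≤ ν.dualNorm := by
  have hinj : Function.Injective (Ub.compLinear φ hu) := fun f g h => Ub.ext fun y => by
    obtain ⟨x, rfl⟩ := hs y
    exact congrArg (fun k : Ub X => k.1 x) h
  let e := LinearEquiv.ofInjective (Ub.compLinear φ hu) hinj
  let ν' : Ub Y →ₗ[ℝ] ℝ :=
    { toFun := fun f => ν f
      map_add' := map_add ν
      map_smul' := map_smul ν }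
  let p : Ub X →ₗ.[ℝ] ℝ := ⟨LinearMap.range (Ub.compLinear φ hu), ν' ∘ₗ e.symm.toLinearMap⟩
  have hp : ∀ f : Ub Y, p (e f) = ν f := fun f => by
    change ν (e.symm (e f)) = ν f
    rw [e.symm_apply_apply]
  obtain ⟨g, hgp, hgN⟩ := exists_extension_of_le_sublinear p (fun f => ν.dualNorm * ‖f‖)
    (fun c hc f => by
      have : ‖c • f‖ = c * ‖f‖ :=
        (norm_smul c f.1).trans (by rw [Real.norm_of_nonneg hc.le]; rfl)
      rw [this]
      ring)
    (fun f g => by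
      rw [← mul_add]
      exact mul_le_mul_of_nonneg_left (norm_add_le f.1 g.1) ν.dualNorm_nonneg)
    (fun f => by
      obtain ⟨f', rfl⟩ := e.surjective f
      rw [hp]
      refine (le_abs_self _).trans (ν.abs_apply_le (norm_nonneg (e f').1.1) fun y => ?_)
      obtain ⟨x, rfl⟩ := hs y
      exact Ub.abs_apply_le (Ub.compLinear φ hu f') x)
  have hgc : Continuous g := by
    refine AddMonoidHomClass.continuous_of_bound g ν.dualNorm fun f => abs_le'.2 ⟨hgN f, ?_⟩
    rw [← map_neg]
    refine (hgN (-f)).trans_eq ?_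
    rw [show ‖-f‖ = ‖f‖ from norm_neg f.1]
  refine ⟨UniformConvergenceCLM.ofFun (RingHom.id ℝ) ℝ {H | IsUeb H} ⟨g, hgc⟩, ?_, ?_⟩
  · refine UniformConvergenceCLM.ext _ _ fun f => ?_
    exact (hgp (e f)).trans (hp f)
  · refine csSup_le ⟨_, 0, fun x => by simp, rfl⟩ ?_
    rintro _ ⟨f, hf, rfl⟩
    refine (hgN f).trans (mul_le_of_le_one_right ν.dualNorm_nonneg ?_)
    exact (Ub.norm_le_iff zero_le_one).2 hf

/-- A functional on `Y` that is tight along a locally inducing surjection `φ : X → Y` is the image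
of a uniform measure on `X`. A norm-preserving extension `m` of `ν` is tight, because a function on `Y`
that almost attains the norm of `ν` controls the variation of `m`. -/
theorem IsLocallyInducing.exists_map_eq_of_isTight [Nonempty X] (hφ : IsLocallyInducing φ)
    (hu : UniformContinuous φ) (hs : Function.Surjective φ) {ν : UbDual Y} (hν : IsTight φ ν) :
    ∃ m ∈ UMeas X, UbDual.map φ hu m = ν := by
  have : Nonempty Y := ‹Nonempty X›.map φ
  obtain ⟨m, rfl, hle⟩ := exists_map_eq_of_surjective hu hs ν
  refine ⟨m, mem_UMeas_of_isTight fun E hE ε hε => ?_, rfl⟩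
  obtain ⟨E', hE', hψ⟩ := hφ.exists_bump hE
  obtain ⟨K, hK⟩ := hν E' hE' (ε / 2) (half_pos hε)
  obtain ⟨ψ, hψ0, hψ1, hψK, hψE⟩ := hψ K
  obtain ⟨g, hg, hgm⟩ := (UbDual.map φ hu m).exists_dualNorm_sub_le_apply (half_pos hε)
  refine ⟨K, fun h h1 h2 => ?_⟩
  have hh : ∀ x, |h.1 x| ≤ (Ub.comp φ hu ψ).1 x := fun x => by
    rw [Ub.comp_apply]
    rcases lt_or_ge (ψ.1 (φ x)) 1 with hx | hx
    · obtain ⟨k, hk, hkx⟩ := hψE x hx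
      have := h2 k hk x hkx
      rw [id] at this
      rw [this, abs_zero]
      exact hψ0 _
    · exact (h1 x).trans hx
  have h3 := abs_apply_le_of_dualNorm_sub_le m (g := Ub.comp φ hu g) (fun x => hg (φ x))
    ((sub_le_sub_right hle _).trans hgm) (fun x => hψ1 (φ x)) hh
  have h4 : |m (Ub.comp φ hu (Ub.mul g ψ))| ≤ ε / 2 := by
    refine hK (Ub.mul g ψ) (fun y => ?_) fun k hk x hx => ?_
    · rw [Ub.mul_apply, abs_mul, abs_of_nonneg (hψ0 y)]
      exact mul_le_one₀ (hg y) (hψ0 y) (hψ1 y)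
    · rw [Ub.mul_apply, hψK k hk x hx, mul_zero]
  have h5 : m (Ub.mul (Ub.comp φ hu g) (Ub.comp φ hu ψ)) ≤ ε / 2 := (le_abs_self _).trans h4
  linarith

end Lifting

/-! ### Several uniformities on one set -/

section Uniformities

variable {X : Type*} {u u₁ u₂ v v' : UniformSpace X}

theorem IsLocallyInducing.mono_right (h : IsLocallyInducing (WithUniformity.idMap u v))
    (hv : v' ≤ v) : IsLocallyInducing (WithUniformity.idMap u v') := by
  intro E hE
  obtain ⟨E', hE', hx⟩ := h E hE
  refine ⟨E', hE', fun x => ?_⟩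
  obtain ⟨F, hF, hFE⟩ := hx x
  exact ⟨F, hv hF, hFE⟩

theorem mem_uniformity_inf_iff {E : Set (X × X)} :
    E ∈ 𝓤[u₁ ⊓ u₂] ↔ ∃ E₁ ∈ 𝓤[u₁], ∃ E₂ ∈ 𝓤[u₂], E₁ ∩ E₂ ⊆ E :=
  mem_inf_iff_superset

theorem IsLocallyInducing.inf (h₁ : IsLocallyInducing (WithUniformity.idMap u₁ v))
    (h₂ : IsLocallyInducing (WithUniformity.idMap u₂ v)) :
    IsLocallyInducing (WithUniformity.idMap (u₁ ⊓ u₂) v) := by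
  intro E hE
  obtain ⟨E₁, hE₁, E₂, hE₂, hE⟩ := mem_uniformity_inf_iff.1 hE
  obtain ⟨D₁, hD₁, hx₁⟩ := h₁ E₁ hE₁
  obtain ⟨D₂, hD₂, hx₂⟩ := h₂ E₂ hE₂
  refine ⟨D₁ ∩ D₂, mem_uniformity_inf_iff.2 ⟨D₁, hD₁, D₂, hD₂, Subset.rfl⟩, fun x => ?_⟩
  obtain ⟨F₁, hF₁, hFE₁⟩ := hx₁ x
  obtain ⟨F₂, hF₂, hFE₂⟩ := hx₂ x
  exact ⟨F₁ ∩ F₂, inter_mem hF₁ hF₂, fun z y hz hy =>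
    hE ⟨hFE₁ z y hz.1 hy.1, hFE₂ z y hz.2 hy.2⟩⟩

/-- A functional that is concentrated near finitely many points for each of two uniformities is so
for their common refinement: a ball of the one and a ball of the other uniformity that meet do so
inside a ball of the common refinement. A bump function splits each test function into two parts,
one for each of the two uniformities. -/
theorem IsTight.inf [Nonempty X] (h₁ : IsLocallyInducing (WithUniformity.idMap u₁ v))
    {ν : UbDual (WithUniformity v)} (hν₁ : IsTight (WithUniformity.idMap u₁ v) ν)
    (hν₂ : IsTight (WithUniformity.idMap u₂ v) ν) :
    IsTight (WithUniformity.idMap (u₁ ⊓ u₂) v) ν := by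
  classical
  have : Nonempty (WithUniformity v) := ‹Nonempty X›
  intro E hE ε hε
  obtain ⟨E₁, hE₁, E₂, hE₂, hE⟩ := mem_uniformity_inf_iff.1 hE
  obtain ⟨D₁, hD₁, hs₁, hc₁⟩ := comp_symm_mem_uniformity_sets (α := WithUniformity u₁) hE₁
  obtain ⟨D₂, hD₂, hs₂, hc₂⟩ := comp_symm_mem_uniformity_sets (α := WithUniformity u₂) hE₂
  obtain ⟨D, hD, hψ⟩ := h₁.exists_bump hD₁
  obtain ⟨K₁, hK₁⟩ := hν₁ D hD (ε / 2) (half_pos hε)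
  obtain ⟨K₂, hK₂⟩ := hν₂ D₂ hD₂ (ε / 2) (half_pos hε)
  obtain ⟨ψ, hψ0, hψ1, hψK, hψE⟩ := hψ K₁
  -- `c (k, l)` lies in both the `D₁`-ball of `k` and the `D₂`-ball of `l`, if these meet
  let c : X × X → X := fun p =>
    if hp : ∃ x, (p.1, x) ∈ D₁ ∧ (p.2, x) ∈ D₂ then hp.choose else p.1
  refine ⟨(K₁ ×ˢ K₂ : Finset (X × X)).image c, fun h hh1 hh0 => ?_⟩
  have hsplit : h = Ub.mul h ψ + Ub.mul h (Ub.one - ψ) := Ub.ext fun x => by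
    rw [Ub.add_apply, Ub.mul_apply, Ub.mul_apply, Ub.sub_apply, Ub.one_apply]
    ring
  have b1 : |ν (Ub.mul h ψ)| ≤ ε / 2 := by
    refine hK₁ _ (fun y => ?_) fun k hk x hx => ?_
    · rw [Ub.mul_apply, abs_mul, abs_of_nonneg (hψ0 y)]
      exact mul_le_one₀ (hh1 y) (hψ0 y) (hψ1 y)
    · rw [Ub.mul_apply, hψK k hk x hx, mul_zero]
  have b2 : |ν (Ub.mul h (Ub.one - ψ))| ≤ ε / 2 := by
    refine hK₂ _ (fun y => ?_) fun l hl x hx => ?_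
    · have h1 : 0 ≤ 1 - ψ.1 y := sub_nonneg.2 (hψ1 y)
      rw [Ub.mul_apply, Ub.sub_apply, Ub.one_apply, abs_mul, abs_of_nonneg h1]
      exact mul_le_one₀ (hh1 y) h1 (by linarith [hψ0 y])
    · rw [Ub.mul_apply, Ub.sub_apply, Ub.one_apply]
      rcases lt_or_ge (ψ.1 x) 1 with hx1 | hx1
      · obtain ⟨k, hk, hkx⟩ := hψE x hx1
        have hp : ∃ z, (k, z) ∈ D₁ ∧ (l, z) ∈ D₂ := ⟨x, hkx, hx⟩
        have hc : c (k, l) = hp.choose := dif_pos hp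
        have hz : h.1 (WithUniformity.idMap u₂ v x) = 0 := by
          refine hh0 (c (k, l)) (Finset.mem_image_of_mem c (Finset.mk_mem_product hk hl)) x
            (hE ⟨hc₁ ⟨k, ?_, hkx⟩, hc₂ ⟨l, ?_, hx⟩⟩)
          · rw [hc]
            exact hs₁.symm _ _ hp.choose_spec.1
          · rw [hc]
            exact hs₂.symm _ _ hp.choose_spec.2
        rw [hz, zero_mul]
      · rw [le_antisymm (hψ1 (WithUniformity.idMap u₂ v x)) hx1, sub_self, mul_zero]
  rw [hsplit, map_add]
  linarith [abs_add_le (ν (Ub.mul h ψ)) (ν (Ub.mul h (Ub.one - ψ)))]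

/-- If the identity is locally inducing from `u₁` and `u₂` to `v`, then a functional comes from a
uniform measure for `u₁ ⊓ u₂` as soon as it comes from uniform measures for `u₁` and for `u₂`. -/
theorem range_idMeas_inf [Nonempty X] (hu₁ : u₁ ≤ v) (hu₂ : u₂ ≤ v)
    (h₁ : IsLocallyInducing (WithUniformity.idMap u₁ v))
    (h₂ : IsLocallyInducing (WithUniformity.idMap u₂ v)) :
    range (idMeas (inf_le_left.trans hu₁ : u₁ ⊓ u₂ ≤ v)) =
      range (idMeas hu₁) ∩ range (idMeas hu₂) := by
  have n₁ : Nonempty (WithUniformity u₁) := ‹Nonempty X›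
  have n₂ : Nonempty (WithUniformity u₂) := ‹Nonempty X›
  have n : Nonempty (WithUniformity (u₁ ⊓ u₂)) := ‹Nonempty X›
  refine Subset.antisymm ?_ ?_
  · rintro _ ⟨m, rfl⟩
    exact ⟨⟨idMeas inf_le_left m, rfl⟩, ⟨idMeas inf_le_right m, rfl⟩⟩
  · rintro ν ⟨⟨m₁, hm₁⟩, ⟨m₂, hm₂⟩⟩
    have t₁ : IsTight (WithUniformity.idMap u₁ v) ν.1 := by
      rw [← hm₁]
      exact (isTight_of_mem_UMeas m₁.2).map _
    have t₂ : IsTight (WithUniformity.idMap u₂ v) ν.1 := by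
      rw [← hm₂]
      exact (isTight_of_mem_UMeas m₂.2).map _
    obtain ⟨m, hm, hmν⟩ := (h₁.inf h₂).exists_map_eq_of_isTight
      (WithUniformity.uniformContinuous_idMap (inf_le_left.trans hu₁)) (fun x => ⟨x, rfl⟩)
      (IsTight.inf h₁ t₁ t₂)
    exact ⟨⟨m, hm⟩, Subtype.ext hmν⟩

end Uniformities

/-! ### Topological groups -/

section Groups

/-- Neighbourhoods of the identity for a word in three letters that is trivial at the identity. -/
theorem exists_nhds_one_of_continuous {G : Type*} [Group G] [TopologicalSpace G]
    {w : G × G × G → G} (hw : Continuous w) (h1 : w (1, 1, 1) = 1)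
    {U : Set G} (hU : U ∈ 𝓝 (1 : G)) :
    ∃ V ∈ 𝓝 (1 : G), ∀ a ∈ V, ∀ b ∈ V, ∀ c ∈ V, w (a, b, c) ∈ U := by
  have h := hw.tendsto (1, 1, 1)
  rw [h1, nhds_prod_eq, nhds_prod_eq] at h
  obtain ⟨A, hA, B, hB, hAB⟩ := mem_prod_iff.1 (h hU)
  obtain ⟨C, hC, D, hD, hCD⟩ := mem_prod_iff.1 hB
  exact ⟨A ∩ (C ∩ D), inter_mem hA (inter_mem hC hD), fun a ha b hb c hc =>
    hAB ⟨ha.1, hCD ⟨hb.2.1, hc.2.2⟩⟩⟩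

variable (G : Type*) [Group G] [TopologicalSpace G] [IsTopologicalGroup G]

/-- The sets `{(x, y) | y ∈ U * x * U}` are entourages of the lower uniformity: they are a base of a
uniformity that is coarser than both the left and the right one. -/
theorem mem_uniformity_lowerUnif {U : Set G} (hU : U ∈ 𝓝 (1 : G)) :
    {p : G × G | ∃ a ∈ U, ∃ b ∈ U, p.2 = a * p.1 * b} ∈ (lowerUnif G).uniformity := by
  let S : Set G → Set (G × G) := fun U => {p | ∃ a ∈ U, ∃ b ∈ U, p.2 = a * p.1 * b}
  have hS : Monotone S := fun U V hUV p ⟨a, ha, b, hb, h⟩ => ⟨a, hUV ha, b, hUV hb, h⟩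
  have hmem : ∀ r : Set (G × G), r ∈ (𝓝 (1 : G)).lift' S ↔ ∃ U ∈ 𝓝 (1 : G), S U ⊆ r :=
    fun r => mem_lift'_sets hS
  let c : UniformSpace.Core G := UniformSpace.Core.mk' ((𝓝 (1 : G)).lift' S)
    (fun r hr x => by
      obtain ⟨U, hU, hUr⟩ := (hmem r).1 hr
      exact hUr ⟨1, mem_of_mem_nhds hU, 1, mem_of_mem_nhds hU, by simp⟩)
    (fun r hr => by
      obtain ⟨U, hU, hUr⟩ := (hmem r).1 hr
      refine (hmem _).2 ⟨U⁻¹, inv_mem_nhds_one G hU, ?_⟩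
      rintro ⟨x, y⟩ ⟨a, ha, b, hb, h⟩
      refine hUr ⟨a⁻¹, ha, b⁻¹, hb, ?_⟩
      simp only [Prod.fst_swap, Prod.snd_swap] at h ⊢
      rw [h]
      group)
    (fun r hr => by
      obtain ⟨U, hU, hUr⟩ := (hmem r).1 hr
      obtain ⟨V, hV, hVU⟩ := exists_nhds_one_split hU
      refine ⟨S V, (hmem _).2 ⟨V, hV, Subset.rfl⟩, Subset.trans ?_ hUr⟩
      rintro ⟨x, y⟩ ⟨z, ⟨a, ha, b, hb, h⟩, ⟨a', ha', b', hb', h'⟩⟩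
      refine ⟨a' * a, hVU _ ha' _ ha, b * b', hVU _ hb _ hb', ?_⟩
      simp only at h h' ⊢
      rw [h', h]
      group)
  have hl : leftUnif G ≤ UniformSpace.ofCore c := by
    intro r hr
    obtain ⟨U, hU, hUr⟩ := (hmem r).1 hr
    refine ⟨U, hU, fun p hp => hUr ⟨1, mem_of_mem_nhds hU, p.1⁻¹ * p.2, hp, ?_⟩⟩
    group
  have hr : rightUnif G ≤ UniformSpace.ofCore c := by
    intro r hr
    obtain ⟨U, hU, hUr⟩ := (hmem r).1 hr
    refine ⟨U, hU, fun p hp => hUr ⟨p.2 * p.1⁻¹, hp, 1, mem_of_mem_nhds hU, ?_⟩⟩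
    group
  exact sup_le hl hr ((hmem _).2 ⟨U, hU, Subset.rfl⟩)

/-- If `z = x * v` and `y = a * z * b`, then `z⁻¹ * y = v⁻¹ * (x⁻¹ * a * x) * v * b`. For `v` in a
fixed neighbourhood of the identity this is small as soon as `a` and `b` are small depending on `x`. -/
theorem isLocallyInducing_left_lower :
    IsLocallyInducing (WithUniformity.idMap (leftUnif G) (lowerUnif G)) := by
  rintro E ⟨U, hU, hUE⟩
  obtain ⟨V, hV, hVU⟩ := exists_nhds_one_of_continuous
    (w := fun p : G × G × G => p.1⁻¹ * p.2.1 * p.1 * p.2.2) (by fun_prop) (by simp) hU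
  refine ⟨{p : G × G | p.1⁻¹ * p.2 ∈ V}, ⟨V, hV, Subset.rfl⟩, fun (x : G) => ?_⟩
  have hx : {a : G | x⁻¹ * a * x ∈ V} ∈ 𝓝 (1 : G) := by
    have hc : Continuous fun a : G => x⁻¹ * a * x := by fun_prop
    exact hc.continuousAt.preimage_mem_nhds (by simpa using hV)
  refine ⟨_, mem_uniformity_lowerUnif G (inter_mem hV hx), fun (z y : G) hz hy => hUE ?_⟩
  obtain ⟨a, ha, b, hb, h⟩ := hy
  have h' : y = a * z * b := h
  have key := hVU (x⁻¹ * z) hz (x⁻¹ * a * x) ha.2 b hb.1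
  have e : (x⁻¹ * z)⁻¹ * (x⁻¹ * a * x) * (x⁻¹ * z) * b = z⁻¹ * y := by
    rw [h']
    group
  change z⁻¹ * y ∈ U
  rw [← e]
  exact key

/-- The mirror image of the left case: if `z = v * x` and `y = a * z * b`, then
`y * z⁻¹ = a * v * (x * b * x⁻¹) * v⁻¹`. -/
theorem isLocallyInducing_right_lower :
    IsLocallyInducing (WithUniformity.idMap (rightUnif G) (lowerUnif G)) := by
  rintro E ⟨U, hU, hUE⟩
  obtain ⟨V, hV, hVU⟩ := exists_nhds_one_of_continuous
    (w := fun p : G × G × G => p.1 * p.2.1 * p.2.2 * p.2.1⁻¹) (by fun_prop) (by simp) hU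
  refine ⟨{p : G × G | p.2 * p.1⁻¹ ∈ V}, ⟨V, hV, Subset.rfl⟩, fun (x : G) => ?_⟩
  have hx : {b : G | x * b * x⁻¹ ∈ V} ∈ 𝓝 (1 : G) := by
    have hc : Continuous fun b : G => x * b * x⁻¹ := by fun_prop
    exact hc.continuousAt.preimage_mem_nhds (by simpa using hV)
  refine ⟨_, mem_uniformity_lowerUnif G (inter_mem hV hx), fun (z y : G) hz hy => hUE ?_⟩
  obtain ⟨a, ha, b, hb, h⟩ := hy
  have h' : y = a * z * b := h
  have key := hVU a ha.1 (z * x⁻¹) hz (x * b * x⁻¹) hb.2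
  have e : a * (z * x⁻¹) * (x * b * x⁻¹) * (z * x⁻¹)⁻¹ = y * z⁻¹ := by
    rw [h']
    group
  change y * z⁻¹ ∈ U
  rw [← e]
  exact key

end Groups

theorem mainTheorem1 (G : Type*) [Group G] [TopologicalSpace G] [IsTopologicalGroup G]
    [T2Space G] :
    (Function.Injective (idMeas (upper_le_left G)) ∧
      Topology.IsEmbedding (idMeasPos (upper_le_left G))) ∧
    (Function.Injective (idMeas (upper_le_right G)) ∧
      Topology.IsEmbedding (idMeasPos (upper_le_right G))) ∧
    (Function.Injective (idMeas (left_le_lower G)) ∧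
      Topology.IsEmbedding (idMeasPos (left_le_lower G))) ∧
    (Function.Injective (idMeas (right_le_lower G)) ∧
      Topology.IsEmbedding (idMeasPos (right_le_lower G))) ∧
    (Function.Injective (idMeas (upper_le_lower G)) ∧
      Topology.IsEmbedding (idMeasPos (upper_le_lower G))) ∧
    Set.range (idMeas (upper_le_lower G)) =
      Set.range (idMeas (left_le_lower G)) ∩ Set.range (idMeas (right_le_lower G)) := by
  have hL := isLocallyInducing_left_lower G
  have hR := isLocallyInducing_right_lower G
  have hU : IsLocallyInducing (WithUniformity.idMap (upperUnif G) (lowerUnif G)) := hL.inf hR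
  have main : ∀ {u v : UniformSpace G} (h : u ≤ v),
      IsLocallyInducing (WithUniformity.idMap u v) →
      Function.Injective (idMeas h) ∧ Topology.IsEmbedding (idMeasPos h) := by
    intro u v h hi
    have : Nonempty (WithUniformity u) := ⟨(1 : G)⟩
    exact ⟨hi.injective_map (WithUniformity.uniformContinuous_idMap h),
      hi.isEmbedding_mapPos (WithUniformity.uniformContinuous_idMap h)⟩
  exact ⟨main _ (hU.mono_right (left_le_lower G)), main _ (hU.mono_right (right_le_lower G)),
    main _ hL, main _ hR, main _ hU, range_idMeas_inf _ _ hL hR⟩
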